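/- Let $\mathcal P=\{x\in\mathbb R^p: Cx\le d\}$ be a compact polyhedron with at least two points, with rows $C_i$ of $C$, vertex set $V$ and diameter $D$. Let $f_1,\dots,f_n:\mathbb R^p\to\mathbb R$ ($n\ge1$) be differentiable, $f_i$ strongly convex with parameter $\sigma_i>0$ and with $L_i$-Lipschitz gradient. Put $F=\frac1n\sum_i f_i$, $F^*=\min_{\mathcal P}F$, $\sigma_F=\min_i\sigma_i$, $L_F=\max_i L_i$, and $\Omega_{\mathcal P}=\zeta/\phi$, where $\zeta$ is the smallest positive value of $d_i-\langle C_i,v\rangle$ over vertices $v$ and constraints $i$, and $\phi$ is the largest $\|C_i\|$ over the constraints $i$ that are not active at all vertices. Away-step stochastic Frank–Wolfe (ASFW) starts at a vertex $x^{(1)}$ with active set $U^{(1)}=\{x^{(1)}\}$ and weight $\mu_{x^{(1)}}=1$. In iteration $k=1,2,\dots$ it draws $m^{(k)}$ independent uniform indices $\xi_1,\dots,\xi_{m^{(k)}}$ from $\{1,\dots,n\}$ (independently of the other iterations) and evaluates the $m^{(k)}$ stochastic gradients $\nabla f_{\xi_j}(x^{(k)})$. It forms their mean $g$, the mean $L^{(k)}$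 of the $L_{\xi_j}$ and $F^{(k)}=\frac1{m^{(k)}}\sum_j f_{\xi_j}$, and takes a vertex $v\in\arg\min_{y\in\mathcal P}\langle g,y\rangle$ and $u\in\arg\max_{w\in U^{(k)}}\langle g,w\rangle$. If $\langle g,v+u-2x^{(k)}\rangle\le0$, it sets $\delta=v-x^{(k)}$ and $\gamma_{\max}=1$; otherwise $\delta=x^{(k)}-u$ and $\gamma_{\max}=\mu_u/(1-\mu_u)$. It sets $x^{(k+1)}=x^{(k)}+\gamma\delta$, where $\gamma=\min\{-\langle g,\delta\rangle/(L^{(k)}\|\delta\|^2),\gamma_{\max}\}$ or $\gamma$ is obtained by exact line search for $F^{(k)}$ on $[0,\gamma_{\max}]$ (if $\delta=0$, the iterate does not move). In the first case it replaces $\mu_w$ by $(1-\gamma)\mu_w$ for $w\ne v$ and $\mu_v$ by $(1-\gamma)\mu_v+\gamma$, and the new active set is $\{v\}$ if the new $\mu_v$ is $1$ and $U^{(k)}\cup\{v\}$ otherwise. In the second case it replaces $\mu_w$ by $(1+\gamma)\mu_w$ for $w\ne u$ and $\mu_u$ by $(1+\gamma)\mu_u-\gamma$, and removes $u$ from the active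 set if the new $\mu_u$ is $0$. Optionally, the resulting representation of $x^{(k+1)}$ is reduced by Carathéodory's theorem to at most $p+1$ of its vertices in every iteration. Let $N=p+1$ with this option and $N=|V|$ without it, and $$\rho=\min\Big\{\tfrac12,\ \frac{\Omega_{\mathcal P}^2\sigma_F}{16N^2L_FD^2}\Big\},\qquad m^{(k)}=\big\lceil (1-\rho)^{-(2k+2)}\big\rceil .$$ Then there are $\beta\in(0,1)$ with $$0<\eta:=\frac{\log(1-\rho)}{\log(1-\beta)}<1$$ and constants $C_2,K$, depending only on the problem data ($C$, $d$, $f_i$, $\sigma_i$, $L_i$) and on whether the Carathéodory option is used, such that every sequence generated by ASFW satisfies $$\mathbb E\{F(x^{(k+1)})-F^*\}\le C_2(1-\beta)^{(k-1)/2}\qquad(k\ge1),$$ and such that, for every $\varepsilon\in(0,1]$, the number $\sum_{i=1}^k m^{(i)}$ of stochastic gradient evaluations performed until an $\varepsilon$-accurate solution is obtained for the first time, i.e. until the first $k\ge0$ with $\mathbb E\{F(x^{(k+1)})-F^*\}\le\varepsilon$, is at most $K(1/\varepsilon)^{4\eta}$. That is, ASFW requires $O((1/\varepsilon)^{4\eta})$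 stochastic gradient evaluations with $0<\eta<1$. -/

import Mathlib

open scoped NNReal

noncomputable section

namespace ASFW

/-- The space `ℝᵖ` with its Euclidean norm and inner product. -/
abbrev Vec (p : ℕ) : Type := EuclideanSpace ℝ (Fin p)

/-- Data of a finite-sum problem over a polyhedron: minimise `(1/n) ∑ᵢ fᵢ(x)` subject to
`⟨Cᵢ, x⟩ ≤ dᵢ`, `i = 1, …, m`, together with moduli `σᵢ` of strong convexity and Lipschitz
constants `Lᵢ` of the gradients. -/
structure Problem (p m n : ℕ) where
  /-- rows of the constraint matrix -/
  C : Fin m → Vec p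
  /-- right-hand side of the constraints -/
  d : Fin m → ℝ
  /-- the summands of the objective -/
  f : Fin n → Vec p → ℝ
  /-- strong convexity parameters -/
  σ : Fin n → ℝ
  /-- Lipschitz constants of the gradients -/
  L : Fin n → ℝ≥0

/-- How the vertex representation is maintained: by the plain update, or with an additional
reduction of the representation by Carathéodory's theorem. -/
inductive Mode : Type
  | plain
  | caratheodory

/-- Iterate `x`, set `U` of active vertices, and weights `μ` (zero outside `U`). -/
structure State (p : ℕ) where
  x : Vec p
  U : Finset (Vec p)
  μ : Vec p → ℝ

namespace Problem

variable {p m n : ℕ} (Q : Problem p m n)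

/-- The feasible set `{x | C x ≤ d}`. -/
def feasible : Set (Vec p) := {x | ∀ i, inner ℝ (Q.C i) x ≤ Q.d i}

/-- The vertices (extreme points) of the feasible set. -/
def vertices : Set (Vec p) := Set.extremePoints ℝ Q.feasible

/-- The objective `F = (1/n) ∑ᵢ fᵢ`. -/
def objective (x : Vec p) : ℝ := (1 / (n : ℝ)) * ∑ i, Q.f i x

/-- The optimal value `F*`. -/
def optValue : ℝ := sInf (Q.objective '' Q.feasible)

/-- Smallest positive slack of a constraint at a vertex. -/
def minSlack : ℝ :=
  sInf {r | ∃ v ∈ Q.vertices, ∃ i, inner ℝ (Q.C i) v < Q.d i ∧ r = Q.d i - inner ℝ (Q.C i) v}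

/-- Largest norm of a constraint row, over the constraints not active at all vertices. -/
def maxRowNorm : ℝ :=
  sSup {r | ∃ i, ¬ (∀ v ∈ Q.vertices, inner ℝ (Q.C i) v = Q.d i) ∧ r = ‖Q.C i‖}

/-- The vertex-facet distance constant of the polytope. -/
def facetConst : ℝ := Q.minSlack / Q.maxRowNorm

/-- `σ_F = minᵢ σᵢ`. -/
def σF : ℝ := ⨅ i, Q.σ i

/-- `L_F = maxᵢ Lᵢ`. -/
def LF : ℝ := ⨆ i, (Q.L i : ℝ)

/-- `N`, the bound on the number of vertices used to represent an iterate. -/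
def repSize : Mode → ℕ
  | Mode.plain => Q.vertices.ncard
  | Mode.caratheodory => p + 1

/-- `ρ = min {1/2, Ω² σ_F / (16 N² L_F D²)}`. -/
def rho (c : Mode) : ℝ :=
  min (1 / 2) (Q.facetConst ^ 2 * Q.σF /
    (16 * (Q.repSize c : ℝ) ^ 2 * Q.LF * Metric.diam Q.feasible ^ 2))

/-- The batch size `m⁽ⁱ⁾ = ⌈1 / (1 - ρ)^(2i+2)⌉`. -/
def batch (c : Mode) (i : ℕ) : ℕ := ⌈1 / (1 - Q.rho c) ^ (2 * i + 2)⌉₊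

/-- Number of stochastic gradients evaluated in iterations `1, …, k`. -/
def gradEvals (c : Mode) (k : ℕ) : ℕ := ∑ i ∈ Finset.Icc 1 k, Q.batch c i

/-- Sampled objective `F⁽ᵏ⁾`, from the first `M` entries of the sample `s`. -/
def sampleObjective (M : ℕ) (s : ℕ → Fin n) (x : Vec p) : ℝ :=
  (1 / (M : ℝ)) * ∑ j ∈ Finset.range M, Q.f (s j) x

/-- Stochastic gradient `g⁽ᵏ⁾`. -/
def sampleGrad (M : ℕ) (s : ℕ → Fin n) (x : Vec p) : Vec p :=
  (1 / (M : ℝ)) • ∑ j ∈ Finset.range M, gradient (Q.f (s j)) x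

/-- Sampled Lipschitz constant `L⁽ᵏ⁾`. -/
def sampleL (M : ℕ) (s : ℕ → Fin n) : ℝ :=
  (1 / (M : ℝ)) * ∑ j ∈ Finset.range M, (Q.L (s j) : ℝ)

end Problem

/-- The test deciding for a Frank-Wolfe step (true) or an away step (false). -/
def IsForward {p : ℕ} (g x v u : Vec p) : Prop := inner ℝ g (v + u - (2 : ℝ) • x) ≤ 0

open Classical in
/-- The direction: `v - x` in a Frank-Wolfe step, `x - u` in an away step. -/
def direction {p : ℕ} (g x v u : Vec p) : Vec p := if IsForward g x v u then v - x else x - u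

open Classical in
/-- The maximal step length. -/
def maxStep {p : ℕ} (g v u : Vec p) (S : State p) : ℝ :=
  if IsForward g S.x v u then 1 else S.μ u / (1 - S.μ u)

open Classical in
/-- The vertex representation update: new active set and new weights after a step of length `γ`
towards `v` (Frank-Wolfe step) or away from `u` (away step). -/
def updateRep {p : ℕ} (g v u : Vec p) (γ : ℝ) (S : State p) : Finset (Vec p) × (Vec p → ℝ) :=
  if IsForward g S.x v u then
    (if S.μ v * (1 - γ) + γ = 1 then {v} else S.U ∪ {v},
      fun w => if w = v then S.μ v * (1 - γ) + γ else S.μ w * (1 - γ))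
  else
    (if S.μ u * (1 + γ) - γ = 0 then S.U \ {u} else S.U,
      fun w => if w = u then S.μ u * (1 + γ) - γ else S.μ w * (1 + γ))

open Classical in
/-- The initial state: the vertex `x₁` with weight one. -/
def initState {p : ℕ} (x₁ : Vec p) : State p := ⟨x₁, {x₁}, fun w => if w = x₁ then 1 else 0⟩

/-- From the representation `R` produced by the update, the representation `(S'.U, S'.μ)` of the
new iterate `S'.x`. It is `R` itself in plain mode; in Carathéodory mode it is any representation of
`S'.x` as a convex combination of at most `p + 1` of the vertices in `R`. -/
def RepAfter {p : ℕ} (R : Finset (Vec p) × (Vec p → ℝ)) (S' : State p) : Mode → Prop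
  | Mode.plain => S'.U = R.1 ∧ S'.μ = R.2
  | Mode.caratheodory =>
      S'.U ⊆ R.1 ∧ S'.U.card ≤ p + 1 ∧ (∀ w ∈ S'.U, 0 ≤ S'.μ w) ∧ (∀ w, w ∉ S'.U → S'.μ w = 0) ∧
        ∑ w ∈ S'.U, S'.μ w = 1 ∧ ∑ w ∈ S'.U, S'.μ w • w = S'.x

/-- One iteration of the away-step stochastic Frank-Wolfe algorithm with the first `M` entries of
the sample `s`. The linear oracle returns a vertex `v`, and ties are broken arbitrarily. The step
length `γ` is the adaptive one or comes from exact line search on the sampled objective. -/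
def Step {p m n : ℕ} (Q : Problem p m n) (c : Mode) (M : ℕ) (s : ℕ → Fin n) (S S' : State p) :
    Prop :=
  ∃ (g v u dir : Vec p) (γ γmax : ℝ),
    g = Q.sampleGrad M s S.x ∧
    (v ∈ Q.vertices ∧ ∀ y ∈ Q.feasible, inner ℝ g v ≤ inner ℝ g y) ∧
    (u ∈ S.U ∧ ∀ w ∈ S.U, inner ℝ g w ≤ inner ℝ g u) ∧
    dir = direction g S.x v u ∧
    γmax = maxStep g v u S ∧
    (γ = min (-(inner ℝ g dir) / (Q.sampleL M s * ‖dir‖ ^ 2)) γmax ∨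
      (γ ∈ Set.Icc 0 γmax ∧ ∀ t ∈ Set.Icc 0 γmax,
        Q.sampleObjective M s (S.x + γ • dir) ≤ Q.sampleObjective M s (S.x + t • dir))) ∧
    S'.x = S.x + γ • dir ∧
    RepAfter (updateRep g v u γ S) S' c

/-- `S 1, S 2, …` is the random sequence generated by the algorithm, where `ξ k 0, ξ k 1, …` are
the indices sampled in iteration `k`: all are independent and uniform on the `n` indices, and
iteration `k` uses the first `m⁽ᵏ⁾` of them. -/
structure IsRun {p m n : ℕ} (Q : Problem p m n) (c : Mode) {Ω : Type*} [MeasurableSpace Ω]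
    (prob : MeasureTheory.Measure Ω) (ξ : ℕ → ℕ → Ω → Fin n) (S : ℕ → Ω → State p) : Prop where
  sample_measurable : ∀ k j, Measurable (ξ k j)
  sample_indep : ProbabilityTheory.iIndepFun (fun kj : ℕ × ℕ => ξ kj.1 kj.2) prob
  sample_uniform : ∀ k j i, prob {ω | ξ k j ω = i} = 1 / (n : ENNReal)
  init : ∃ x₁ ∈ Q.vertices, ∀ ω, S 1 ω = initState x₁
  step : ∀ k, 1 ≤ k → ∀ ω, Step Q c (Q.batch c k) (fun j => ξ k j ω) (S k ω) (S (k + 1) ω)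
  iterate_measurable : ∀ k, 1 ≤ k → Measurable (fun ω => (S k ω).x)

/-- Expected optimality gap `𝔼 {F(x⁽ᵏ⁾) - F*}`. -/
def expGap {p m n : ℕ} (Q : Problem p m n) {Ω : Type*} [MeasurableSpace Ω]
    (prob : MeasureTheory.Measure Ω) (S : ℕ → Ω → State p) (k : ℕ) : ℝ :=
  ∫ ω, (Q.objective (S k ω).x - Q.optValue) ∂prob

end ASFW

end

noncomputable section

namespace ASFW

/-! ### First-order bounds for smooth and strongly convex functions. -/

section FirstOrder

variable {E : Type*} [NormedAddCommGroup E] [InnerProductSpace ℝ E] [CompleteSpace E]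

/-! Fix one iteration and its sampled objective. Strong convexity bounds the gap to a feasible point
`y` by `⟨g, x - y⟩`, and a polyhedral argument bounds `⟨g, x - y⟩` by a multiple of the pairwise gap
`⟨g, u - v⟩` (`exists_transport`, `inner_sub_mul_facetConst_le`). The chosen direction captures at
least half of the pairwise gap, so a step with quadratic decrease contracts the sampled gap by a
factor `1 - b` (`mul_gap_le`). The only steps without contraction are away steps of maximal length,
which do not increase the sampled objective and remove an active vertex (`step_spec`).

These drop steps are amortised by a potential. With `q = √(1 - b)`, the quantity `q⁻¹ ^ |U| * (F x -
F*)` shrinks by the factor `q` in either case: a contracting step gains `q²` and loses at most one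
factor `q⁻¹` through a new vertex, while a drop step gains `q` from the lost vertex
(`potential_step`).

Passing from the sampled objective to `F` costs a multiple of the deviation of the sample's index
frequencies from `1 / n`. This bound is uniform over the polytope, so no conditioning on the past is
needed. Its expectation is at most `n / √m⁽ᵏ⁾ ≤ n (1 - ρ)^(k+1)`. Since `1 - ρ < q`, the accumulated
errors decay like `q ^ k` as well, and the expected gap is `O(q ^ k)` (`expGap_le`).

The batch sizes grow with ratio `(1 - ρ)⁻²`, which equals `(1 / q) ^ (4η)`. Their sum up to the
first accurate iteration is therefore `O((1 / ε) ^ (4η))`. The choice `β = 3ρ/2` makes both `1 - ρ <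
√(1 - β)` and `η < 1` hold. -/

lemma hasDerivAt_comp_line {f : E → ℝ} (hf : Differentiable ℝ f) (x δ : E) (t : ℝ) :
    HasDerivAt (fun t : ℝ => f (x + t • δ)) (inner ℝ (gradient f (x + t • δ)) δ) t := by
  have h1 : HasDerivAt (fun t : ℝ => x + t • δ) δ t := by
    simpa using ((hasDerivAt_id t).smul_const δ).const_add x
  have h2 := (hf (x + t • δ)).hasFDerivAt.comp_hasDerivAt t h1
  rwa [← inner_gradient_left] at h2

/-- Quadratic upper bound for a function with Lipschitz gradient. -/
lemma le_quadratic_of_lipschitz_gradient {f : E → ℝ} {L : ℝ≥0} (hf : Differentiable ℝ f)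
    (hL : LipschitzWith L (gradient f)) (x δ : E) :
    f (x + δ) ≤ f x + inner ℝ (gradient f x) δ + L / 2 * ‖δ‖ ^ 2 := by
  -- The function along the line minus its claimed majorant, up to a constant; the Lipschitz bound
  -- makes it decreasing for `t ≥ 0`.
  set φ : ℝ → ℝ := fun t =>
    f (x + t • δ) - t * inner ℝ (gradient f x) δ - L / 2 * ‖δ‖ ^ 2 * t ^ 2 with hφ
  have hd : ∀ t, HasDerivAt φ (inner ℝ (gradient f (x + t • δ)) δ
      - inner ℝ (gradient f x) δ - L * ‖δ‖ ^ 2 * t) t := by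
    intro t
    have h1 := hasDerivAt_comp_line hf x δ t
    have h2 := (hasDerivAt_id t).mul_const (inner ℝ (gradient f x) δ)
    have h3 := ((hasDerivAt_id t).pow 2).const_mul (L / 2 * ‖δ‖ ^ 2)
    refine ((h1.sub h2).sub h3).congr_deriv ?_
    simp
    ring
  have hanti : AntitoneOn φ (Set.Ici 0) := by
    refine antitoneOn_of_deriv_nonpos (convex_Ici 0)
      (fun t _ => (hd t).continuousAt.continuousWithinAt)
      (fun t _ => (hd t).differentiableAt.differentiableWithinAt) fun t ht => ?_
    rw [interior_Ici] at ht
    have ht0 : 0 < t := ht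
    rw [(hd t).deriv, ← inner_sub_left]
    have h1 := real_inner_le_norm (gradient f (x + t • δ) - gradient f x) δ
    have h2 := hL.norm_sub_le (x + t • δ) x
    rw [add_sub_cancel_left, norm_smul, Real.norm_of_nonneg ht0.le] at h2
    have h3 := mul_le_mul_of_nonneg_right h2 (norm_nonneg δ)
    nlinarith
  have := hanti (Set.mem_Ici.2 le_rfl) (Set.mem_Ici.2 zero_le_one) zero_le_one
  simp only [hφ, one_smul, zero_smul, add_zero] at this
  linarith

/-- Quadratic lower bound for a differentiable strongly convex function. -/
lemma quadratic_le_of_strongConvexOn {f : E → ℝ} {σ : ℝ} (hf : Differentiable ℝ f)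
    (hσ : StrongConvexOn Set.univ σ f) (x δ : E) :
    f x + inner ℝ (gradient f x) δ + σ / 2 * ‖δ‖ ^ 2 ≤ f (x + δ) := by
  have hc := strongConvexOn_iff_convex.1 hσ
  -- Subtracting `σ / 2 * ‖·‖ ^ 2` leaves a convex function of `t`, whose derivative at `0` is at
  -- most its slope from `0` to `1`.
  have hline : ConvexOn ℝ Set.univ
      (fun t : ℝ => f (x + t • δ) - σ / 2 * ‖x + t • δ‖ ^ 2) := by
    have := hc.comp_affineMap (AffineMap.lineMap x (x + δ) : ℝ →ᵃ[ℝ] E)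
    refine this.congr fun t _ => ?_
    simp [AffineMap.lineMap_apply, add_comm]
  have hsq : ∀ t : ℝ, ‖x + t • δ‖ ^ 2 = ‖x‖ ^ 2 + 2 * t * inner ℝ x δ + t ^ 2 * ‖δ‖ ^ 2 := by
    intro t
    rw [norm_add_sq_real, real_inner_smul_right, norm_smul, mul_pow, Real.norm_eq_abs, sq_abs]
    ring
  have hd : HasDerivAt (fun t : ℝ => f (x + t • δ) - σ / 2 * ‖x + t • δ‖ ^ 2)
      (inner ℝ (gradient f x) δ - σ * inner ℝ x δ) 0 := by
    have h1 := hasDerivAt_comp_line hf x δ 0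
    have h2 := ((((hasDerivAt_id (0 : ℝ)).const_mul 2).mul_const (inner ℝ x δ)).const_add
      (‖x‖ ^ 2)).add (((hasDerivAt_id (0 : ℝ)).pow 2).mul_const (‖δ‖ ^ 2))
    have h3 := h1.sub (h2.const_mul (σ / 2))
    simp only [hsq]
    refine h3.congr_deriv ?_
    simp
    ring
  have := hline.le_slope_of_hasDerivAt (Set.mem_univ _) (Set.mem_univ _) zero_lt_one hd
  rw [slope_def_field] at this
  simp only [hsq] at this
  simp only [one_smul, zero_smul, add_zero] at this
  linarith

end FirstOrder

/-! ### Vertices of the polytope and the facet-distance constant. -/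

namespace Problem

variable {p m n : ℕ} (Q : Problem p m n)

lemma feasible_eq_iInter : Q.feasible = ⋂ i, {x | inner ℝ (Q.C i) x ≤ Q.d i} := by
  ext; simp [feasible]

lemma convex_feasible : Convex ℝ Q.feasible := by
  rw [feasible_eq_iInter]
  exact convex_iInter fun i => convex_halfSpace_le (innerₛₗ ℝ (Q.C i)).isLinear _

/-- Finitely many nonnegative numbers stay nonnegative under a small perturbation that does not
decrease the vanishing ones. -/
lemma exists_pos_forall_add_mul_le {ι : Type*} [Finite ι] {a b : ι → ℝ} (ha : ∀ i, 0 ≤ a i)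
    (hab : ∀ i, a i = 0 → 0 ≤ b i) {δ : ℝ} (hδ : 0 < δ) :
    ∃ ε, 0 < ε ∧ ε ≤ δ ∧ ∀ i, 0 ≤ a i + ε * b i := by
  have h : ∀ i, ∀ᶠ ε in nhdsWithin (0 : ℝ) (Set.Ioi 0), 0 ≤ a i + ε * b i := by
    intro i
    rcases (ha i).eq_or_lt with h0 | hpos
    · filter_upwards [self_mem_nhdsWithin] with ε hε
      rw [← h0, zero_add]
      exact mul_nonneg (le_of_lt hε) (hab i h0.symm)
    · have : Filter.Tendsto (fun ε : ℝ => a i + ε * b i) (nhds 0) (nhds (a i + 0 * b i)) := by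
        apply Continuous.tendsto; fun_prop
      rw [zero_mul, add_zero] at this
      exact nhdsWithin_le_nhds ((this.eventually (lt_mem_nhds hpos)).mono fun _ h => h.le)
  have h2 : ∀ᶠ ε in nhdsWithin (0 : ℝ) (Set.Ioi 0), ε ∈ Set.Ioc 0 δ := Ioc_mem_nhdsGT hδ
  obtain ⟨ε, h3, h4⟩ := ((Filter.eventually_all.2 h).and h2).exists
  exact ⟨ε, h4.1, h4.2, h3⟩

/-- If `w` keeps all constraints active at `v` tight, then `v - ε (w - v)` is still feasible for
small `ε > 0`, so `v` lies strictly between two feasible points unless `w = v`. Hence the active set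
determines a vertex, which gives finiteness. -/
lemma vertex_eq_of_active_subset {v w : Vec p} (hv : v ∈ Q.vertices) (hw : w ∈ Q.feasible)
    (h : ∀ i, inner ℝ (Q.C i) v = Q.d i → inner ℝ (Q.C i) w = Q.d i) : w = v := by
  have hv' := mem_extremePoints_iff_left.1 hv
  obtain ⟨ε, hε, -, hε'⟩ := exists_pos_forall_add_mul_le
    (a := fun i => Q.d i - inner ℝ (Q.C i) v)
    (b := fun i => inner ℝ (Q.C i) (w - v)) (fun i => sub_nonneg.2 (hv'.1 i))
    (fun i hi => by
      rw [sub_eq_zero] at hi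
      rw [inner_sub_right, h i hi.symm, hi, sub_self]) one_pos
  refine hv'.2 w hw (v - ε • (w - v)) (fun i => ?_) ?_
  · have := hε' i
    rw [inner_sub_right, real_inner_smul_right]
    linarith
  · refine ⟨ε / (1 + ε), 1 / (1 + ε), by positivity, by positivity, by field_simp; ring, ?_⟩
    have : (1 + ε) ≠ 0 := by positivity
    rw [← smul_right_injective _ this |>.eq_iff]
    simp only [smul_add, smul_smul]
    rw [mul_div_cancel₀ _ this, mul_div_cancel₀ _ this]
    module

lemma finite_vertices : Q.vertices.Finite := by
  classical
  refine Set.Finite.of_finite_image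
    (f := fun v => Finset.univ.filter fun i => inner ℝ (Q.C i) v = Q.d i)
    (Set.toFinite _) fun v hv w hw h => ?_
  refine (Q.vertex_eq_of_active_subset hv hw.1 fun i hi => ?_).symm
  have : i ∈ Finset.univ.filter fun i => inner ℝ (Q.C i) v = Q.d i := by simpa using hi
  rw [show (Finset.univ.filter fun i => inner ℝ (Q.C i) v = Q.d i) = _ from h] at this
  simpa using this

variable {Q}

lemma nontrivial_vertices (hc : IsCompact Q.feasible) (hn : Q.feasible.Nontrivial) :
    Q.vertices.Nontrivial := by
  by_contra h
  have hs := Set.not_nontrivial_iff.1 h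
  have hk := closure_convexHull_extremePoints hc Q.convex_feasible
  obtain ⟨x, hx, y, hy, hxy⟩ := hn
  rcases hs.eq_empty_or_singleton with h0 | ⟨v, h0⟩
  · rw [show Set.extremePoints ℝ Q.feasible = ∅ from h0] at hk
    simp at hk
    simp [← hk] at hx
  · rw [show Set.extremePoints ℝ Q.feasible = {v} from h0] at hk
    simp at hk
    rw [← hk] at hx hy
    exact hxy (hx.trans hy.symm)

/-- Two distinct vertices are separated by a constraint active at only one of them. This makes the
sets defining `minSlack` and `maxRowNorm` nonempty and links the two constants through the diameter.
-/
lemma exists_slack_pos (hc : IsCompact Q.feasible) (hn : Q.feasible.Nontrivial) :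
    ∃ v ∈ Q.vertices, ∃ w ∈ Q.vertices, ∃ i, inner ℝ (Q.C i) v = Q.d i ∧
      inner ℝ (Q.C i) w < Q.d i := by
  obtain ⟨v, hv, w, hw, hvw⟩ := nontrivial_vertices hc hn
  by_contra! h
  exact hvw (Q.vertex_eq_of_active_subset hv hw.1 fun i hi =>
    le_antisymm (hw.1 i) (h v hv w hw i hi)).symm

variable (Q) in
lemma finite_slacks : {r | ∃ v ∈ Q.vertices, ∃ i, inner ℝ (Q.C i) v < Q.d i ∧
    r = Q.d i - inner ℝ (Q.C i) v}.Finite := by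
  refine ((Q.finite_vertices.prod (Set.finite_univ (α := Fin m))).image
    fun vi => Q.d vi.2 - inner ℝ (Q.C vi.2) vi.1).subset ?_
  rintro r ⟨v, hv, i, -, rfl⟩
  exact ⟨(v, i), ⟨hv, trivial⟩, rfl⟩

lemma minSlack_pos (hc : IsCompact Q.feasible) (hn : Q.feasible.Nontrivial) : 0 < Q.minSlack := by
  obtain ⟨v, hv, w, hw, i, hi, hi'⟩ := exists_slack_pos hc hn
  have hne : {r | ∃ v ∈ Q.vertices, ∃ i, inner ℝ (Q.C i) v < Q.d i ∧
      r = Q.d i - inner ℝ (Q.C i) v}.Nonempty := ⟨_, w, hw, i, hi', rfl⟩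
  obtain ⟨u, -, j, hj, h⟩ := hne.csInf_mem Q.finite_slacks
  rw [minSlack, h]
  linarith

lemma minSlack_le {v : Vec p} (hv : v ∈ Q.vertices) {i : Fin m}
    (hi : inner ℝ (Q.C i) v < Q.d i) : Q.minSlack ≤ Q.d i - inner ℝ (Q.C i) v :=
  csInf_le Q.finite_slacks.bddBelow ⟨v, hv, i, hi, rfl⟩

lemma norm_le_maxRowNorm {v : Vec p} (hv : v ∈ Q.vertices) {i : Fin m}
    (hi : inner ℝ (Q.C i) v < Q.d i) : ‖Q.C i‖ ≤ Q.maxRowNorm := by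
  refine le_csSup (Set.Finite.bddAbove ?_) ⟨i, fun h => hi.ne (h v hv), rfl⟩
  refine (Set.finite_range fun i => ‖Q.C i‖).subset ?_
  rintro r ⟨i, -, rfl⟩
  exact ⟨i, rfl⟩

lemma minSlack_le_mul_diam (hc : IsCompact Q.feasible) (hn : Q.feasible.Nontrivial) :
    Q.minSlack ≤ Q.maxRowNorm * Metric.diam Q.feasible := by
  obtain ⟨v, hv, w, hw, i, hi, hi'⟩ := exists_slack_pos hc hn
  calc Q.minSlack ≤ Q.d i - inner ℝ (Q.C i) w := minSlack_le hw hi'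
    _ = inner ℝ (Q.C i) (v - w) := by rw [inner_sub_right, hi]
    _ ≤ ‖Q.C i‖ * ‖v - w‖ := real_inner_le_norm _ _
    _ ≤ _ := by
      rw [← dist_eq_norm]
      exact mul_le_mul (norm_le_maxRowNorm hw hi')
        (Metric.dist_le_diam_of_mem hc.isBounded hv.1 hw.1) dist_nonneg
        ((norm_nonneg _).trans (norm_le_maxRowNorm hw hi'))

lemma diam_pos (hc : IsCompact Q.feasible) (hn : Q.feasible.Nontrivial) :
    0 < Metric.diam Q.feasible := Metric.diam_pos hn hc.isBounded

lemma maxRowNorm_pos (hc : IsCompact Q.feasible) (hn : Q.feasible.Nontrivial) :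
    0 < Q.maxRowNorm := by
  have h1 := minSlack_pos hc hn
  have h2 := minSlack_le_mul_diam hc hn
  have h3 := diam_pos hc hn
  by_contra h
  nlinarith

lemma facetConst_pos (hc : IsCompact Q.feasible) (hn : Q.feasible.Nontrivial) :
    0 < Q.facetConst := div_pos (minSlack_pos hc hn) (maxRowNorm_pos hc hn)

lemma facetConst_le_diam (hc : IsCompact Q.feasible) (hn : Q.feasible.Nontrivial) :
    Q.facetConst ≤ Metric.diam Q.feasible := by
  rw [facetConst, div_le_iff₀ (maxRowNorm_pos hc hn), mul_comm]
  exact minSlack_le_mul_diam hc hn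

/-! ### Transport of weights and the pairwise gap. -/

/-- A convex combination `x` of vertices can be moved to the feasible point `y` by transporting
weights `l w` of its vertices `w` to feasible points, each weight being controlled by `‖x - y‖`. -/
lemma exists_transport (hc : IsCompact Q.feasible) (hn : Q.feasible.Nontrivial)
    {U : Finset (Vec p)} (hU : ↑U ⊆ Q.vertices) {μ : Vec p → ℝ} (hμ : ∀ w ∈ U, 0 ≤ μ w)
    (hμ1 : ∑ w ∈ U, μ w = 1) {x y : Vec p} (hx : ∑ w ∈ U, μ w • w = x) (hy : y ∈ Q.feasible) :
    ∃ l : Vec p → ℝ, (∀ w ∈ U, 0 ≤ l w ∧ l w * Q.facetConst ≤ ‖x - y‖) ∧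
      ∀ i, inner ℝ (Q.C i) (y - x + ∑ w ∈ U, l w • w) ≤ (∑ w ∈ U, l w) * Q.d i := by
  classical
  -- Admissible transports take at most the available weight `μ w` from each vertex. Taking all of
  -- it is admissible, because the transported point is then `y` itself. The transport of least
  -- total weight is the one used.
  set A : Set (U → ℝ) := {l | (∀ w : U, l w ∈ Set.Icc 0 (μ w)) ∧
    ∀ i, inner ℝ (Q.C i) (y - x + ∑ w, l w • (w : Vec p)) ≤ (∑ w, l w) * Q.d i} with hA
  have hAc : IsCompact A := by
    have hbox : IsCompact (Set.univ.pi fun w : U => Set.Icc 0 (μ w)) :=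
      isCompact_univ_pi fun w => isCompact_Icc
    refine hbox.of_isClosed_subset ?_ fun l hl => ?_
    · have : A = (Set.univ.pi fun w : U => Set.Icc 0 (μ w)) ∩ ⋂ i,
          {l | inner ℝ (Q.C i) (y - x + ∑ w, l w • (w : Vec p)) ≤ (∑ w, l w) * Q.d i} := by
        ext l
        simp only [hA, Set.mem_ofPred_eq, Set.mem_inter_iff, Set.mem_univ_pi, Set.mem_iInter]
      rw [this]
      refine hbox.isClosed.inter (isClosed_iInter fun i => isClosed_le ?_ ?_) <;> fun_prop
    · exact Set.mem_univ_pi.2 hl.1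
  have hAne : A.Nonempty := by
    refine ⟨fun w => μ w, fun w => ⟨hμ w w.2, le_rfl⟩, fun i => ?_⟩
    rw [Finset.sum_coe_sort U (fun w => μ w • w), Finset.sum_coe_sort U μ, hx, hμ1]
    simpa using hy i
  obtain ⟨l, hl, hmin⟩ := hAc.exists_isMinOn hAne
    (f := fun l => ∑ w, l w) (Continuous.continuousOn (by fun_prop))
  have key : ∀ w, l w * Q.facetConst ≤ ‖x - y‖ := by
    intro w
    rcases (hl.1 w).1.eq_or_lt with h0 | hpos
    · rw [← h0]; simp
    -- Minimality: if every tight constraint were also active at `w`, a little of `l w` could be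
    -- saved without violating any constraint.
    have htight : ∃ i, inner ℝ (Q.C i) (y - x + ∑ w, l w • (w : Vec p)) = (∑ w, l w) * Q.d i ∧
        inner ℝ (Q.C i) (w : Vec p) < Q.d i := by
      by_contra! hcon
      obtain ⟨ε, hε, hεl, hε'⟩ := exists_pos_forall_add_mul_le
        (a := fun i => (∑ w, l w) * Q.d i - inner ℝ (Q.C i) (y - x + ∑ w, l w • (w : Vec p)))
        (b := fun i => inner ℝ (Q.C i) (w : Vec p) - Q.d i)
        (fun i => sub_nonneg.2 (hl.2 i))
        (fun i hi => sub_nonneg.2 (hcon i (sub_eq_zero.1 hi).symm)) hpos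
      have hsum : ∑ z, (l z - if z = w then ε else 0) = ∑ z, l z - ε := by
        rw [Finset.sum_sub_distrib]; simp
      have hsum' : ∑ z, (l z - if z = w then ε else 0) • (z : Vec p)
          = ∑ z, l z • (z : Vec p) - ε • (w : Vec p) := by
        simp_rw [sub_smul]
        rw [Finset.sum_sub_distrib]
        simp [ite_smul]
      have hmem : (fun z => l z - if z = w then ε else 0) ∈ A := by
        refine ⟨fun z => ?_, fun i => ?_⟩
        · have := hl.1 z
          by_cases hz : z = w
          · subst hz
            simp only [if_true]
            exact ⟨by linarith, by linarith [this.2]⟩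
          · simpa [hz] using this
        · simp only [hsum, hsum']
          have := hε' i
          rw [← add_sub_assoc, inner_sub_right, real_inner_smul_right]
          linarith
      have := hmin hmem
      rw [Set.mem_ofPred_eq] at this
      beta_reduce at this
      rw [hsum] at this
      linarith
    obtain ⟨i, hi, hwi⟩ := htight
    have hslack : ∀ z : U, 0 ≤ Q.d i - inner ℝ (Q.C i) (z : Vec p) := fun z =>
      sub_nonneg.2 ((hU z.2).1 i)
    -- Tightness of constraint `i` balances the total slack of the removed vertices against `⟨Cᵢ, y
    -- - x⟩`. All summands are nonnegative, so the one of `w` alone is controlled.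
    have h1 : ∑ z, l z * (Q.d i - inner ℝ (Q.C i) (z : Vec p)) = inner ℝ (Q.C i) (y - x) := by
      rw [inner_add_right, inner_sum, Finset.sum_mul] at hi
      simp only [real_inner_smul_right] at hi
      simp only [mul_sub]
      rw [Finset.sum_sub_distrib]
      linarith
    have h2 : l w * (Q.d i - inner ℝ (Q.C i) (w : Vec p)) ≤ inner ℝ (Q.C i) (y - x) := by
      rw [← h1]
      exact Finset.single_le_sum (f := fun z => l z * (Q.d i - inner ℝ (Q.C i) (z : Vec p)))
        (fun z _ => mul_nonneg (hl.1 z).1 (hslack z)) (Finset.mem_univ w)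
    have h3 : inner ℝ (Q.C i) (y - x) ≤ Q.maxRowNorm * ‖x - y‖ := by
      rw [norm_sub_rev]
      exact (real_inner_le_norm _ _).trans
        (mul_le_mul_of_nonneg_right (norm_le_maxRowNorm (hU w.2) hwi) (norm_nonneg _))
    have h4 := mul_le_mul_of_nonneg_left (minSlack_le (hU w.2) hwi) hpos.le
    rw [facetConst, ← mul_div_assoc, div_le_iff₀ (maxRowNorm_pos hc hn)]
    linarith
  refine ⟨fun w => if h : w ∈ U then l ⟨w, h⟩ else 0, fun w hw => ?_, fun i => ?_⟩
  · simp only [hw, dif_pos]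
    exact ⟨(hl.1 _).1, key _⟩
  · have := hl.2 i
    rw [← Finset.sum_coe_sort U, ← Finset.sum_coe_sort U]
    simpa using this

/-- The pairwise gap of a linear functional over the active vertices and the polytope dominates
its decrease towards any feasible point. -/
lemma inner_sub_mul_facetConst_le (hc : IsCompact Q.feasible) (hn : Q.feasible.Nontrivial)
    {U : Finset (Vec p)} (hU : ↑U ⊆ Q.vertices) {μ : Vec p → ℝ} (hμ : ∀ w ∈ U, 0 ≤ μ w)
    (hμ1 : ∑ w ∈ U, μ w = 1) {x y : Vec p} (hx : ∑ w ∈ U, μ w • w = x) (hy : y ∈ Q.feasible)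
    {g u v : Vec p} (hu : ∀ w ∈ U, inner ℝ g w ≤ inner ℝ g u)
    (hv : ∀ z ∈ Q.feasible, inner ℝ g v ≤ inner ℝ g z) (huU : u ∈ U) :
    inner ℝ g (x - y) * Q.facetConst ≤ U.card * ‖x - y‖ * inner ℝ g (u - v) := by
  obtain ⟨l, hl, hl'⟩ := exists_transport hc hn hU hμ hμ1 hx hy
  have hgap : 0 ≤ inner ℝ g (u - v) := by
    rw [inner_sub_right, sub_nonneg]
    exact hv u (hU huU).1
  have hΛ : 0 ≤ ∑ w ∈ U, l w := Finset.sum_nonneg fun w hw => (hl w hw).1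
  have h1 : (∑ w ∈ U, l w) * inner ℝ g v ≤ inner ℝ g (y - x + ∑ w ∈ U, l w • w) := by
    -- With zero total weight one cannot rescale to a feasible point. Then `y - x` is a recession
    -- direction, and `g` cannot decrease along it because `v` minimises `g` over the polytope.
    rcases hΛ.eq_or_lt with h0 | hpos
    · have hz : ∀ w ∈ U, l w = 0 :=
        (Finset.sum_eq_zero_iff_of_nonneg fun w hw => (hl w hw).1).1 h0.symm
      have hs : ∑ w ∈ U, l w • w = 0 := Finset.sum_eq_zero fun w hw => by simp [hz w hw]
      rw [← h0, hs] at hl' ⊢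
      simp only [add_zero, zero_mul] at hl' ⊢
      have hxf : x ∈ Q.feasible := by
        rw [← hx]
        exact Q.convex_feasible.sum_mem hμ hμ1 fun w hw => (hU hw).1
      by_contra! hneg
      have hray : ∀ t : ℝ, 0 ≤ t → x + t • (y - x) ∈ Q.feasible := by
        intro t ht i
        rw [inner_add_right, real_inner_smul_right]
        have := mul_nonpos_of_nonneg_of_nonpos ht (hl' i)
        linarith [hxf i]
      have hb := hv _ (hray ((inner ℝ g x - inner ℝ g v + 1) / (-inner ℝ g (y - x)))
        (div_nonneg (by linarith [hv x hxf]) (by linarith)))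
      rw [inner_add_right, real_inner_smul_right] at hb
      have : (inner ℝ g x - inner ℝ g v + 1) / (-inner ℝ g (y - x)) * inner ℝ g (y - x)
          = -(inner ℝ g x - inner ℝ g v + 1) := by
        rw [div_mul_eq_mul_div, div_eq_iff (by linarith)]; ring
      linarith
    · have hz : (∑ w ∈ U, l w)⁻¹ • (y - x + ∑ w ∈ U, l w • w) ∈ Q.feasible := by
        intro i
        rw [real_inner_smul_right, inv_mul_le_iff₀ hpos]
        exact hl' i
      have := hv _ hz
      rwa [real_inner_smul_right, le_inv_mul_iff₀ hpos] at this
  have h2 : inner ℝ g (∑ w ∈ U, l w • w) ≤ (∑ w ∈ U, l w) * inner ℝ g u := by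
    rw [inner_sum, Finset.sum_mul]
    refine Finset.sum_le_sum fun w hw => ?_
    rw [real_inner_smul_right]
    exact mul_le_mul_of_nonneg_left (hu w hw) (hl w hw).1
  have h3 : inner ℝ g (x - y) ≤ (∑ w ∈ U, l w) * inner ℝ g (u - v) := by
    rw [inner_add_right] at h1
    rw [inner_sub_right] at h1 ⊢
    rw [inner_sub_right]
    linarith
  have h4 : (∑ w ∈ U, l w) * Q.facetConst ≤ U.card * ‖x - y‖ := by
    rw [Finset.sum_mul, ← nsmul_eq_mul]
    exact Finset.sum_le_card_nsmul _ _ _ fun w hw => (hl w hw).2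
  have h5 := mul_le_mul_of_nonneg_right h3 (facetConst_pos hc hn).le
  have h6 := mul_le_mul_of_nonneg_right h4 hgap
  linarith

end Problem

/-! ### Decrease from the step-length rules. -/

section StepLength

variable {E : Type*} [NormedAddCommGroup E] [InnerProductSpace ℝ E]

/-- Decrease of a smooth convex function under the adaptive step length or exact line search. -/
lemma stepLength_spec {G : E → ℝ} {x δ g : E} {L γ γmax : ℝ} (hL : 0 < L)
    (hup : ∀ e, G (x + e) ≤ G x + inner ℝ g e + L / 2 * ‖e‖ ^ 2)
    (hconv : ConvexOn ℝ Set.univ G) (hδ : inner ℝ g δ ≤ 0) (hmax : 0 ≤ γmax)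
    (hγ : γ = min (-(inner ℝ g δ) / (L * ‖δ‖ ^ 2)) γmax ∨
      (γ ∈ Set.Icc 0 γmax ∧ ∀ t ∈ Set.Icc 0 γmax, G (x + γ • δ) ≤ G (x + t • δ))) :
    γ ∈ Set.Icc 0 γmax ∧ G (x + γ • δ) ≤ G x ∧
      (γ < γmax → G (x + γ • δ) ≤ G x - inner ℝ g δ ^ 2 / (2 * L * ‖δ‖ ^ 2)) ∧
      (G (x + γ • δ) ≤ G x - inner ℝ g δ ^ 2 / (2 * L * ‖δ‖ ^ 2) ∨
        G (x + γ • δ) ≤ G x + γmax * inner ℝ g δ / 2) := by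
  set a : ℝ := -inner ℝ g δ with ha
  have hga : inner ℝ g δ = -a := by rw [ha, neg_neg]
  have ha0 : 0 ≤ a := by linarith
  set T : ℝ := a / (L * ‖δ‖ ^ 2) with hT
  have hT0 : 0 ≤ T := by positivity
  have hTa : T * (L * ‖δ‖ ^ 2) ≤ a := by
    rcases eq_or_ne (L * ‖δ‖ ^ 2) 0 with h | h
    · rw [h, mul_zero]; exact ha0
    · exact (div_mul_cancel₀ _ h).le
  have hq : ∀ t, 0 ≤ t → t ≤ T → G (x + t • δ) ≤ G x - t * a / 2 := by
    intro t ht htT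
    have h1 := hup (t • δ)
    rw [real_inner_smul_right, norm_smul, mul_pow, Real.norm_eq_abs, sq_abs, hga] at h1
    have h2 : t * (L * ‖δ‖ ^ 2) ≤ a :=
      (mul_le_mul_of_nonneg_right htT (by positivity)).trans hTa
    have h3 := mul_le_mul_of_nonneg_left h2 ht
    linarith
  have hTT : G (x + T • δ) ≤ G x - inner ℝ g δ ^ 2 / (2 * L * ‖δ‖ ^ 2) := by
    have h1 := hq T hT0 le_rfl
    have h2 : T * a / 2 = inner ℝ g δ ^ 2 / (2 * L * ‖δ‖ ^ 2) := by
      rw [hga, hT, div_mul_eq_mul_div, div_div]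
      congr 1 <;> ring
    rwa [h2] at h1
  have hmem : min T γmax ∈ Set.Icc 0 γmax := ⟨le_min hT0 hmax, min_le_right _ _⟩
  have hmono := hq (min T γmax) hmem.1 (min_le_left _ _)
  have hdec : G (x + min T γmax • δ) ≤ G x := hmono.trans
    (by have := mul_nonneg hmem.1 ha0; linarith)
  have hor : G (x + min T γmax • δ) ≤ G x - inner ℝ g δ ^ 2 / (2 * L * ‖δ‖ ^ 2) ∨
      G (x + min T γmax • δ) ≤ G x + γmax * inner ℝ g δ / 2 := by
    rcases le_total T γmax with h | h
    · left; rwa [min_eq_left h]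
    · right
      rw [min_eq_right h] at hmono ⊢
      rw [hga]; linarith
  rcases hγ with rfl | ⟨hγ, hmin⟩
  · refine ⟨hmem, hdec, fun hlt => ?_, hor⟩
    rcases min_lt_iff.1 hlt with h | h
    · rwa [min_eq_left h.le]
    · exact absurd h (lt_irrefl _)
  · have h0 := hmin _ hmem
    refine ⟨hγ, h0.trans hdec, fun hlt => ?_, hor.imp h0.trans h0.trans⟩
    rcases le_or_gt T γmax with h | h
    · exact (hmin T ⟨hT0, h⟩).trans hTT
    -- Here `γ < γmax < T`. If `T` gave a smaller value than `γ`, convexity would make `γmax`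
    -- strictly better than `γ`, contradicting the line search; so `γ` does at least as well as the
    -- unreachable `T`.
    · refine le_trans ?_ hTT
      by_contra! hcon
      have h1 := hmin γmax ⟨hmax, le_rfl⟩
      have hne : T - γ ≠ 0 := by linarith
      have h2 := hconv.2 (Set.mem_univ (x + γ • δ)) (Set.mem_univ (x + T • δ))
        (show 0 ≤ (T - γmax) / (T - γ) from div_nonneg (by linarith) (by linarith))
        (show 0 ≤ (γmax - γ) / (T - γ) from div_nonneg (by linarith) (by linarith))
        (by field_simp; ring)
      have h3 : ((T - γmax) / (T - γ)) • (x + γ • δ) + ((γmax - γ) / (T - γ)) • (x + T • δ)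
          = x + γmax • δ := by
        match_scalars <;> field_simp <;> ring
      rw [h3, smul_eq_mul, smul_eq_mul] at h2
      have h4 : 0 < (γmax - γ) / (T - γ) := div_pos (by linarith) (by linarith)
      have h5 : (T - γmax) / (T - γ) = 1 - (γmax - γ) / (T - γ) := by field_simp; ring
      rw [h5] at h2
      have h6 := mul_lt_mul_of_pos_left hcon h4
      linarith

end StepLength

/-! ### Problem constants and bounds for the sampled objective. -/

/-- Standing assumptions: a compact feasible set with at least two points and smooth strongly
convex summands. -/
structure Problem.Regular {p m n : ℕ} (Q : Problem p m n) : Prop where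
  pos : 0 < n
  compact : IsCompact Q.feasible
  nontrivial : Q.feasible.Nontrivial
  σ_pos : ∀ i, 0 < Q.σ i
  convex : ∀ i, StrongConvexOn Set.univ (Q.σ i) (Q.f i)
  diff : ∀ i, Differentiable ℝ (Q.f i)
  lip : ∀ i, LipschitzWith (Q.L i) (gradient (Q.f i))

namespace Problem

variable {p m n : ℕ} {Q : Problem p m n}

lemma σF_le (i : Fin n) : Q.σF ≤ Q.σ i := ciInf_le (Set.finite_range _).bddBelow i

lemma le_LF (i : Fin n) : (Q.L i : ℝ) ≤ Q.LF :=
  le_ciSup (f := fun i => (Q.L i : ℝ)) (Set.finite_range _).bddAbove i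

lemma sampleL_le {M : ℕ} (hM : 0 < M) (s : ℕ → Fin n) : Q.sampleL M s ≤ Q.LF := by
  have : (0 : ℝ) < M := by exact_mod_cast hM
  have h := Finset.sum_le_card_nsmul (Finset.range M) (fun j => (Q.L (s j) : ℝ)) Q.LF
    fun j _ => le_LF _
  rw [Finset.card_range, nsmul_eq_mul] at h
  unfold sampleL
  rwa [one_div, inv_mul_le_iff₀ this]

namespace Regular

variable (hQ : Q.Regular)
include hQ

/-- The quadratic lower and upper bounds are compared at two distinct points. In particular the
Lipschitz constants are positive. -/
lemma σ_le_L (i : Fin n) : Q.σ i ≤ Q.L i := by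
  obtain ⟨x, -, y, -, hxy⟩ := hQ.nontrivial
  have h1 := quadratic_le_of_strongConvexOn (hQ.diff i) (hQ.convex i) x (y - x)
  have h2 := le_quadratic_of_lipschitz_gradient (hQ.diff i) (hQ.lip i) x (y - x)
  have h3 : 0 < ‖y - x‖ ^ 2 := by
    have := norm_pos_iff.2 (sub_ne_zero.2 hxy.symm)
    positivity
  by_contra! h
  nlinarith

lemma L_pos (i : Fin n) : (0 : ℝ) < Q.L i := (hQ.σ_pos i).trans_le (hQ.σ_le_L i)

lemma σF_pos : 0 < Q.σF := by
  have : Nonempty (Fin n) := ⟨⟨0, hQ.pos⟩⟩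
  obtain ⟨i, hi⟩ := exists_eq_ciInf_of_finite (f := Q.σ)
  rw [σF, ← hi]
  exact hQ.σ_pos i

lemma σF_le_LF : Q.σF ≤ Q.LF :=
  ((σF_le ⟨0, hQ.pos⟩).trans (hQ.σ_le_L _)).trans (le_LF _)

lemma LF_pos : 0 < Q.LF := hQ.σF_pos.trans_le hQ.σF_le_LF

variable {M : ℕ} (hM : 0 < M) (s : ℕ → Fin n)
include hM

lemma sampleL_pos : 0 < Q.sampleL M s := by
  unfold sampleL
  have : (0 : ℝ) < M := by exact_mod_cast hM
  exact mul_pos (by positivity) (Finset.sum_pos (fun j _ => hQ.L_pos _) (by simpa using hM.ne'))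

lemma sampleObjective_le (x δ : Vec p) : Q.sampleObjective M s (x + δ) ≤
    Q.sampleObjective M s x + inner ℝ (Q.sampleGrad M s x) δ
      + Q.sampleL M s / 2 * ‖δ‖ ^ 2 := by
  have hM' : (0 : ℝ) < M := by exact_mod_cast hM
  have h := Finset.sum_le_sum fun j (_ : j ∈ Finset.range M) =>
    le_quadratic_of_lipschitz_gradient (hQ.diff (s j)) (hQ.lip (s j)) x δ
  rw [Finset.sum_add_distrib, Finset.sum_add_distrib, ← Finset.sum_mul, ← Finset.sum_div] at h
  have h' := mul_le_mul_of_nonneg_left h (one_div_pos.2 hM').le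
  simp only [sampleObjective, sampleGrad, sampleL, real_inner_smul_left, sum_inner]
  linarith

lemma le_sampleObjective (x δ : Vec p) : Q.sampleObjective M s x
    + inner ℝ (Q.sampleGrad M s x) δ + Q.σF / 2 * ‖δ‖ ^ 2 ≤ Q.sampleObjective M s (x + δ) := by
  have hM' : (0 : ℝ) < M := by exact_mod_cast hM
  have h := Finset.sum_le_sum fun j (_ : j ∈ Finset.range M) =>
    quadratic_le_of_strongConvexOn (hQ.diff (s j)) ((hQ.convex (s j)).mono (σF_le _)) x δ
  rw [Finset.sum_add_distrib, Finset.sum_add_distrib, Finset.sum_const, Finset.card_range,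
    nsmul_eq_mul] at h
  have h' := mul_le_mul_of_nonneg_left h (one_div_pos.2 hM').le
  simp only [sampleObjective, sampleGrad, real_inner_smul_left, sum_inner]
  have h2 : 1 / (M : ℝ) * (M * (Q.σF / 2 * ‖δ‖ ^ 2)) = Q.σF / 2 * ‖δ‖ ^ 2 := by field_simp
  linarith

lemma convexOn_sampleObjective : ConvexOn ℝ Set.univ (Q.sampleObjective M s) := by
  refine ⟨convex_univ, fun x _ y _ a b ha hb hab => ?_⟩
  have h := Finset.sum_le_sum fun j (_ : j ∈ Finset.range M) =>
    ((hQ.convex (s j)).strictConvexOn (hQ.σ_pos _)).convexOn.2 (Set.mem_univ x) (Set.mem_univ y)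
      ha hb hab
  simp only [smul_eq_mul] at h
  rw [Finset.sum_add_distrib, ← Finset.mul_sum, ← Finset.mul_sum] at h
  have hM' : (0 : ℝ) < M := by exact_mod_cast hM
  have h' := mul_le_mul_of_nonneg_left h (one_div_pos.2 hM').le
  simp only [sampleObjective, smul_eq_mul]
  linarith

end Regular

/-! ### Representations by vertices. -/

/-- `R` represents `x` as a convex combination of vertices. -/
structure Represents (Q : Problem p m n) (R : Finset (Vec p) × (Vec p → ℝ)) (x : Vec p) : Prop where
  subset : ↑R.1 ⊆ Q.vertices
  nonneg : ∀ w ∈ R.1, 0 ≤ R.2 w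
  eq_zero : ∀ w, w ∉ R.1 → R.2 w = 0
  sum_eq : ∑ w ∈ R.1, R.2 w = 1
  bary : ∑ w ∈ R.1, R.2 w • w = x

namespace Represents

variable {U : Finset (Vec p)} {μ : Vec p → ℝ} {x : Vec p}

lemma mem_feasible (h : Q.Represents (U, μ) x) : x ∈ Q.feasible := by
  rw [← h.bary]
  exact Q.convex_feasible.sum_mem h.nonneg h.sum_eq fun w hw => (h.subset hw).1

lemma card_le (h : Q.Represents (U, μ) x) : U.card ≤ Q.vertices.ncard := by
  rw [← Set.ncard_coe_finset]
  exact Set.ncard_le_ncard h.subset Q.finite_vertices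

lemma restrict (h : Q.Represents (U, μ) x) {U' : Finset (Vec p)} (hU : U' ⊆ U)
    (h0 : ∀ w ∈ U, w ∉ U' → μ w = 0) : Q.Represents (U', μ) x where
  subset := fun w hw => h.subset (hU hw)
  nonneg := fun w hw => h.nonneg w (hU hw)
  eq_zero := fun w hw => by
    by_cases hwU : w ∈ U
    · exact h0 w hwU hw
    · exact h.eq_zero w hwU
  sum_eq := by rw [← h.sum_eq]; exact Finset.sum_subset hU h0
  bary := by
    rw [← h.bary]
    exact Finset.sum_subset hU fun w hw hw' => by
      have : μ w = 0 := h0 w hw hw'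
      simp [this]

lemma eq_of_weight_eq_one (h : Q.Represents (U, μ) x) {v : Vec p} (hv : v ∈ U) (h1 : μ v = 1) :
    ∀ w ∈ U, w ≠ v → μ w = 0 := by
  classical
  have hs : ∑ w ∈ U.erase v, μ w = 0 := by
    have := Finset.add_sum_erase U μ hv
    have h2 : ∑ w ∈ U, μ w = 1 := h.sum_eq
    linarith
  intro w hw hwv
  exact (Finset.sum_eq_zero_iff_of_nonneg fun z hz => h.nonneg z (Finset.mem_of_mem_erase hz)).1
    hs w (Finset.mem_erase.2 ⟨hwv, hw⟩)

lemma weight_le_one (h : Q.Represents (U, μ) x) {v : Vec p} (hv : v ∈ U) : μ v ≤ 1 := by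
  rw [← h.sum_eq]
  exact Finset.single_le_sum h.nonneg hv

-- Negative `a` is allowed on purpose: `a = γ` at `v` is the Frank-Wolfe update, and `a = -γ` at the
-- away vertex is the away update.
open Classical in
lemma affine (h : Q.Represents (U, μ) x) {v : Vec p} (hv : v ∈ Q.vertices) {a : ℝ}
    (h1 : 0 ≤ μ v * (1 - a) + a) (h2 : ∀ w ∈ U, w ≠ v → 0 ≤ μ w * (1 - a)) :
    Q.Represents (U ∪ {v}, fun w => if w = v then μ v * (1 - a) + a else μ w * (1 - a))
      (x + a • (v - x)) := by
  have hform : ∀ w, (if w = v then μ v * (1 - a) + a else μ w * (1 - a))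
      = μ w * (1 - a) + if w = v then a else 0 := by
    intro w
    split_ifs with hw
    · rw [hw]
    · rw [add_zero]
  have hsub : U ⊆ U ∪ {v} := Finset.subset_union_left
  have hs1 : ∑ w ∈ U ∪ {v}, μ w = 1 := by
    rw [← h.sum_eq]
    exact (Finset.sum_subset hsub fun w _ hw => h.eq_zero w hw).symm
  have hs2 : ∑ w ∈ U ∪ {v}, μ w • w = x := by
    rw [← h.bary]
    refine (Finset.sum_subset hsub fun w _ hw => ?_).symm
    have : μ w = 0 := h.eq_zero w hw
    simp [this]
  refine ⟨fun w hw => ?_, fun w hw => ?_, fun w hw => ?_, ?_, ?_⟩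
  · rcases Finset.mem_union.1 hw with hw | hw
    · exact h.subset hw
    · rwa [Finset.mem_singleton.1 hw]
  · dsimp only at hw ⊢
    split_ifs with hwv
    · exact h1
    · rcases Finset.mem_union.1 hw with hw | hw
      · exact h2 w hw hwv
      · exact absurd (Finset.mem_singleton.1 hw) hwv
  · simp only [Finset.mem_union, Finset.mem_singleton, not_or] at hw
    have : μ w = 0 := h.eq_zero w hw.1
    simp [hw.2, this]
  · simp only [hform]
    rw [Finset.sum_add_distrib, ← Finset.sum_mul, hs1]
    simp
  · simp only [hform, add_smul]
    rw [Finset.sum_add_distrib]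
    have : ∑ w ∈ U ∪ {v}, (μ w * (1 - a)) • w = (1 - a) • x := by
      rw [← hs2, Finset.smul_sum]
      exact Finset.sum_congr rfl fun w _ => by rw [mul_comm, mul_smul]
    rw [this]
    simp [ite_smul]
    module

end Represents

lemma represents_initState {x₁ : Vec p} (hx : x₁ ∈ Q.vertices) :
    Q.Represents ((initState x₁).U, (initState x₁).μ) (initState x₁).x := by
  refine ⟨?_, ?_, ?_, ?_, ?_⟩ <;> simp [initState, hx]

end Problem

/-! ### Progress of a single iteration. -/

namespace Problem

variable {p m n : ℕ} {Q : Problem p m n}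

/-- The two candidate directions add up to `v - u`, and the test selects the one with the smaller
inner product, which is at most the average. -/
lemma inner_direction_le (g x v u : Vec p) :
    inner ℝ g (direction g x v u) ≤ -(inner ℝ g (u - v)) / 2 := by
  have h : IsForward g x v u ↔ inner ℝ g v + inner ℝ g u - 2 * inner ℝ g x ≤ 0 := by
    rw [IsForward, inner_sub_right, inner_add_right, real_inner_smul_right]
  unfold direction
  split_ifs with hf
  · rw [h] at hf
    rw [inner_sub_right, inner_sub_right]
    linarith
  · rw [h] at hf
    rw [inner_sub_right, inner_sub_right]
    linarith

lemma isForward_self {g x v : Vec p} (h : inner ℝ g v ≤ inner ℝ g x) : IsForward g x v x := by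
  rw [IsForward, inner_sub_right, inner_add_right, real_inner_smul_right]
  linarith

/-- Linear progress of a step whose decrease is quadratic in the directional derivative. -/
lemma Regular.mul_gap_le (hQ : Q.Regular) {M : ℕ} (hM : 0 < M) (s : ℕ → Fin n)
    {U : Finset (Vec p)} {μ : Vec p → ℝ} {x y u v : Vec p} (hR : Q.Represents (U, μ) x)
    (hy : y ∈ Q.feasible)
    (hu : ∀ w ∈ U, inner ℝ (Q.sampleGrad M s x) w ≤ inner ℝ (Q.sampleGrad M s x) u)
    (huU : u ∈ U) (hvf : v ∈ Q.feasible)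
    (hv : ∀ z ∈ Q.feasible, inner ℝ (Q.sampleGrad M s x) v ≤ inner ℝ (Q.sampleGrad M s x) z)
    {N : ℕ} (hN : U.card ≤ N) {b : ℝ}
    (hb : b * (4 * (N : ℝ) ^ 2 * Q.LF * Metric.diam Q.feasible ^ 2) ≤ Q.facetConst ^ 2 * Q.σF)
    (hpos : 0 ≤ Q.sampleObjective M s x - Q.sampleObjective M s y) :
    b * (Q.sampleObjective M s x - Q.sampleObjective M s y) ≤
      inner ℝ (Q.sampleGrad M s x) (direction (Q.sampleGrad M s x) x v u) ^ 2 /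
        (2 * Q.sampleL M s * ‖direction (Q.sampleGrad M s x) x v u‖ ^ 2) := by
  set g := Q.sampleGrad M s x with hg
  set δ := direction g x v u with hδdef
  set Δ := Q.sampleObjective M s x - Q.sampleObjective M s y with hΔ
  have hL := hQ.sampleL_pos hM s
  rcases hpos.eq_or_lt with h0 | hΔpos
  · rw [← h0, mul_zero]; positivity
  have hσ := hQ.σF_pos
  have hΩ := facetConst_pos hQ.compact hQ.nontrivial
  have hD := diam_pos hQ.compact hQ.nontrivial
  have hxf := hR.mem_feasible
  have hlow := hQ.le_sampleObjective hM s x (y - x)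
  rw [add_sub_cancel, ← hg] at hlow
  have hneg : inner ℝ g (y - x) = -inner ℝ g (x - y) := by rw [← inner_neg_right, neg_sub]
  rw [hneg, norm_sub_rev] at hlow
  set a := inner ℝ g (x - y)
  set r := ‖x - y‖
  set W := inner ℝ g (u - v) with hW
  have hr0 : 0 ≤ r := norm_nonneg _
  have ha : Δ + Q.σF / 2 * r ^ 2 ≤ a := by linarith
  have hapos : 0 < a := lt_of_lt_of_le (by positivity) ha
  have hgap : a * Q.facetConst ≤ U.card * r * W :=
    inner_sub_mul_facetConst_le hQ.compact hQ.nontrivial hR.subset hR.nonneg hR.sum_eq hR.bary hy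
      hu hv huU
  have hW0 : 0 ≤ W := by
    rw [hW, inner_sub_right, sub_nonneg]
    exact hv u (hR.subset huU).1
  have hgap' : a * Q.facetConst ≤ N * r * W := hgap.trans (by gcongr)
  have hNrW : 0 < N * r * W := lt_of_lt_of_le (by positivity) hgap'
  have hrpos : 0 < r := by
    rcases hr0.eq_or_lt with h | h
    · rw [← h] at hNrW; simp at hNrW
    · exact h
  have hWpos : 0 < W := by
    rcases hW0.eq_or_lt with h | h
    · rw [← h] at hNrW; simp at hNrW
    · exact h
  -- AM-GM applied to `Δ` and `σ_F r² / 2`. The resulting `r²` cancels against the one in the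
  -- pairwise gap bound.
  have h1 : 2 * Q.σF * Δ * r ^ 2 ≤ a ^ 2 := by
    have h2 : (Δ + Q.σF / 2 * r ^ 2) ^ 2 ≤ a ^ 2 := by gcongr
    nlinarith [sq_nonneg (Δ - Q.σF / 2 * r ^ 2)]
  have h2 : 2 * Q.σF * Δ * Q.facetConst ^ 2 ≤ (N : ℝ) ^ 2 * W ^ 2 := by
    have h3 : (a * Q.facetConst) ^ 2 ≤ (N * r * W) ^ 2 := by gcongr
    have h4 := mul_le_mul_of_nonneg_right h1 (sq_nonneg Q.facetConst)
    have h5 : (2 * Q.σF * Δ * Q.facetConst ^ 2) * r ^ 2 ≤ ((N : ℝ) ^ 2 * W ^ 2) * r ^ 2 := by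
      linarith
    exact le_of_mul_le_mul_right h5 (by positivity)
  have hNpos : (0 : ℝ) < N := by
    by_contra h
    have : (N : ℝ) = 0 := le_antisymm (not_lt.1 h) (Nat.cast_nonneg _)
    rw [this] at hNrW; simp at hNrW
  have h3 : b * Δ * (8 * Q.LF * Metric.diam Q.feasible ^ 2) ≤ W ^ 2 := by
    have h4 := mul_le_mul_of_nonneg_right hb hΔpos.le
    have h5 : (b * Δ * (8 * Q.LF * Metric.diam Q.feasible ^ 2)) * (N : ℝ) ^ 2
        ≤ W ^ 2 * (N : ℝ) ^ 2 := by linarith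
    exact le_of_mul_le_mul_right h5 (by positivity)
  have hgd : inner ℝ g δ ≤ -W / 2 := inner_direction_le g x v u
  have h4 : b * Δ * (2 * Q.LF * Metric.diam Q.feasible ^ 2) ≤ inner ℝ g δ ^ 2 := by
    have : (W / 2) ^ 2 ≤ (-inner ℝ g δ) ^ 2 := by
      have h5 : W / 2 ≤ -inner ℝ g δ := by linarith
      gcongr
    linarith
  have hδ0 : δ ≠ 0 := by
    intro h
    rw [h, inner_zero_right] at hgd
    linarith
  have hδpos : 0 < ‖δ‖ := norm_pos_iff.2 hδ0
  have hδD : ‖δ‖ ≤ Metric.diam Q.feasible := by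
    rw [hδdef, direction]
    split_ifs
    · rw [← dist_eq_norm]
      exact Metric.dist_le_diam_of_mem hQ.compact.isBounded hvf hxf
    · rw [← dist_eq_norm]
      exact Metric.dist_le_diam_of_mem hQ.compact.isBounded hxf (hR.subset huU).1
  rw [le_div_iff₀ (by positivity)]
  rcases le_or_gt b 0 with hb0 | hb0
  · exact (mul_nonpos_of_nonpos_of_nonneg
      (mul_nonpos_of_nonpos_of_nonneg hb0 hΔpos.le) (by positivity)).trans (sq_nonneg _)
  · refine le_trans ?_ h4
    have := sampleL_le (Q := Q) hM s
    have := hQ.LF_pos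
    gcongr

lemma represents_updateRep {S : State p} (hR : Q.Represents (S.U, S.μ) S.x) {g u v : Vec p}
    (hv : v ∈ Q.vertices) (hu : u ∈ S.U) {γ : ℝ} (hγ : γ ∈ Set.Icc 0 (maxStep g v u S))
    (hμu : ¬ IsForward g S.x v u → S.μ u < 1) :
    Q.Represents (updateRep g v u γ S) (S.x + γ • direction g S.x v u) := by
  classical
  unfold maxStep at hγ
  unfold updateRep direction
  split_ifs at hγ ⊢ with hf h1 h1
  · have hstep := hR.affine hv (a := γ)
      (by
        by_cases hvU : v ∈ S.U
        · have := mul_nonneg (hR.nonneg v hvU) (sub_nonneg.2 hγ.2)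
          simp only at this
          linarith [hγ.1]
        · rw [show S.μ v = 0 from hR.eq_zero v hvU]; linarith [hγ.1])
      (fun w hw _ => mul_nonneg (hR.nonneg w hw) (sub_nonneg.2 hγ.2))
    refine hstep.restrict (by simp) fun w hw hwv => ?_
    exact hstep.eq_of_weight_eq_one (v := v) (by simp) (by simpa using h1) w hw
      (by simpa using hwv)
  · exact hR.affine hv (a := γ)
      (by
        by_cases hvU : v ∈ S.U
        · have := mul_nonneg (hR.nonneg v hvU) (sub_nonneg.2 hγ.2)
          simp only at this
          linarith [hγ.1]
        · rw [show S.μ v = 0 from hR.eq_zero v hvU]; linarith [hγ.1])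
      (fun w hw _ => mul_nonneg (hR.nonneg w hw) (sub_nonneg.2 hγ.2))
  all_goals
    have hlt := hμu hf
    have hγ' : γ * (1 - S.μ u) ≤ S.μ u := (le_div_iff₀ (by linarith)).1 hγ.2
    have hstep := hR.affine (hR.subset hu) (a := -γ) (by linarith)
      (fun w hw _ => mul_nonneg (hR.nonneg w hw) (by linarith [hγ.1]))
    have hUu : S.U ∪ {u} = S.U := Finset.union_eq_left.2 (by simpa using hu)
    have hfun : (fun w => if w = u then S.μ u * (1 - -γ) + -γ else S.μ w * (1 - -γ))
        = fun w => if w = u then S.μ u * (1 + γ) - γ else S.μ w * (1 + γ) := by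
      funext w; simp only [sub_neg_eq_add, ← sub_eq_add_neg]
    have hpt : S.x + -γ • (u - S.x) = S.x + γ • (S.x - u) := by module
    rw [hUu, hfun, hpt] at hstep
  · refine hstep.restrict Finset.sdiff_subset fun w hw hwu => ?_
    have : w = u := by
      by_contra hne
      exact hwu (by simp [hw, hne])
    simpa [this] using h1
  · exact hstep

lemma card_updateRep_le_of_isForward {S : State p} {g u v : Vec p} (γ : ℝ)
    (hf : IsForward g S.x v u) : (updateRep g v u γ S).1.card ≤ S.U.card + 1 := by
  classical
  unfold updateRep
  rw [if_pos hf]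
  split_ifs
  · simp
  · exact (Finset.card_union_le _ _).trans (by simp)

lemma card_updateRep_le_of_not_isForward {S : State p} {g u v : Vec p} (γ : ℝ)
    (hf : ¬ IsForward g S.x v u) : (updateRep g v u γ S).1.card ≤ S.U.card := by
  classical
  unfold updateRep
  rw [if_neg hf]
  split_ifs
  · exact Finset.card_le_card Finset.sdiff_subset
  · exact le_rfl

/-- The maximal away step `μ u / (1 - μ u)` is exactly the length at which the weight of `u`
vanishes. -/
lemma card_updateRep_drop {S : State p} {g u v : Vec p} (hu : u ∈ S.U) (hμ : S.μ u < 1)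
    (hf : ¬ IsForward g S.x v u) :
    (updateRep g v u (maxStep g v u S) S).1.card + 1 ≤ S.U.card := by
  classical
  have h1 : (1 - S.μ u) ≠ 0 := by linarith
  have h2 : S.μ u * (1 + S.μ u / (1 - S.μ u)) - S.μ u / (1 - S.μ u) = 0 := by field_simp; ring
  unfold updateRep maxStep
  rw [if_neg hf, if_neg hf, if_pos h2, Finset.sdiff_singleton_eq_erase,
    Finset.card_erase_add_one hu]

lemma represents_of_repAfter {R : Finset (Vec p) × (Vec p → ℝ)} {S : State p} {c : Mode}
    (hR : Q.Represents R S.x) (h : RepAfter R S c) :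
    Q.Represents (S.U, S.μ) S.x ∧ S.U.card ≤ Q.repSize c ∧ S.U.card ≤ R.1.card := by
  cases c with
  | plain =>
    obtain ⟨hU, hμ⟩ := h
    rw [hU, hμ]
    exact ⟨hR, hR.card_le, le_rfl⟩
  | caratheodory =>
    obtain ⟨h1, h2, h3, h4, h5, h6⟩ := h
    exact ⟨⟨fun w hw => hR.subset (h1 hw), h3, h4, h5, h6⟩, h2, Finset.card_le_card h1⟩

/-- One iteration either contracts the optimality gap of the sampled objective and adds at most
one active vertex, or it does not increase the sampled objective and drops an active vertex. -/
lemma Regular.step_spec (hQ : Q.Regular) {c : Mode} {M : ℕ} (hM : 0 < M) {s : ℕ → Fin n}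
    {S S' : State p} (hR : Q.Represents (S.U, S.μ) S.x) (hcard : S.U.card ≤ Q.repSize c)
    (hstep : Step Q c M s S S') {b : ℝ} (hb0 : 0 ≤ b) (hb2 : b ≤ 1 / 2)
    (hb : b * (4 * (Q.repSize c : ℝ) ^ 2 * Q.LF * Metric.diam Q.feasible ^ 2) ≤
      Q.facetConst ^ 2 * Q.σF) :
    Q.Represents (S'.U, S'.μ) S'.x ∧ S'.U.card ≤ Q.repSize c ∧
    (((∀ y ∈ Q.feasible, Q.sampleObjective M s S'.x - Q.sampleObjective M s y ≤
        (1 - b) * (Q.sampleObjective M s S.x - Q.sampleObjective M s y)) ∧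
        S'.U.card ≤ S.U.card + 1) ∨
      (Q.sampleObjective M s S'.x ≤ Q.sampleObjective M s S.x ∧ S'.U.card + 1 ≤ S.U.card)) := by
  obtain ⟨g, v, u, dir, γ, γmax, rfl, ⟨hv, hvmin⟩, ⟨hu, humax⟩, rfl, rfl, hγ, hx', hrep⟩ := hstep
  set g := Q.sampleGrad M s S.x with hg
  -- If `u` carried all the weight, then `x = u`, and the test would select a Frank-Wolfe step.
  -- Hence the denominator of the maximal away step is positive.
  have hμu : ¬ IsForward g S.x v u → S.μ u < 1 := by
    intro hf
    refine lt_of_le_of_ne (hR.weight_le_one hu) fun h1 => hf ?_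
    have hxu : S.x = u := by
      rw [← hR.bary]
      rw [Finset.sum_eq_single u (fun w hw hwu => by
        rw [show (S.U, S.μ).2 w = 0 from hR.eq_of_weight_eq_one hu h1 w hw hwu, zero_smul])
        (fun h => absurd hu h)]
      rw [show (S.U, S.μ).2 u = 1 from h1, one_smul]
    rw [hxu]
    exact isForward_self (hvmin u (hR.subset hu).1)
  have hmax : 0 ≤ maxStep g v u S := by
    unfold maxStep
    split_ifs with hf
    · exact zero_le_one
    · exact div_nonneg (hR.nonneg u hu) (by linarith [hμu hf])
  have hvu : 0 ≤ inner ℝ g (u - v) := by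
    rw [inner_sub_right, sub_nonneg]
    exact hvmin u (hR.subset hu).1
  have hdir := inner_direction_le g S.x v u
  obtain ⟨hγmem, hmono, hinterior, hor⟩ := stepLength_spec (hQ.sampleL_pos hM s)
    (hQ.sampleObjective_le hM s S.x) (hQ.convexOn_sampleObjective hM s)
    (by linarith : inner ℝ g (direction g S.x v u) ≤ 0) hmax hγ
  have hrep' := represents_updateRep hR hv hu hγmem hμu
  rw [← hx'] at hrep' hmono hinterior hor
  obtain ⟨h1, h2, h3⟩ := represents_of_repAfter hrep' hrep
  refine ⟨h1, h2, ?_⟩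
  have hquad : Q.sampleObjective M s S'.x ≤ Q.sampleObjective M s S.x -
      inner ℝ g (direction g S.x v u) ^ 2 /
        (2 * Q.sampleL M s * ‖direction g S.x v u‖ ^ 2) → ∀ y ∈ Q.feasible,
      Q.sampleObjective M s S'.x - Q.sampleObjective M s y ≤
        (1 - b) * (Q.sampleObjective M s S.x - Q.sampleObjective M s y) := by
    intro h y hy
    rcases le_total 0 (Q.sampleObjective M s S.x - Q.sampleObjective M s y) with h0 | h0
    · have := hQ.mul_gap_le hM s hR hy humax hu hv.1 hvmin hcard hb h0
      linarith
    · have := mul_nonpos_of_nonneg_of_nonpos hb0 h0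
      linarith
  by_cases hf : IsForward g S.x v u
  · refine Or.inl ⟨?_, h3.trans (card_updateRep_le_of_isForward γ hf)⟩
    rcases hor with h | h
    · exact hquad h
    -- With `γmax = 1` the decrease is at least `⟨g, x - v⟩ / 2`. Since `v` minimises `g`, convexity
    -- makes this at least half of the gap to any `y`; this is where `b ≤ 1 / 2` enters.
    · intro y hy
      rw [maxStep, if_pos hf, direction, if_pos hf, one_mul] at h
      have hlow := hQ.le_sampleObjective hM s S.x (y - S.x)
      rw [add_sub_cancel, ← hg] at hlow
      have hσ := hQ.σF_pos
      have h4 : 0 ≤ Q.σF / 2 * ‖y - S.x‖ ^ 2 := by positivity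
      have h5 := hvmin y hy
      rw [inner_sub_right] at h hlow
      rcases le_total 0 (Q.sampleObjective M s S.x - Q.sampleObjective M s y) with h0 | h0
      · have := mul_le_mul_of_nonneg_right hb2 h0
        linarith
      · have := mul_nonpos_of_nonneg_of_nonpos hb0 h0
        linarith
  -- An away step of maximal length is a drop step; a shorter one has the quadratic decrease.
  · rcases hγmem.2.eq_or_lt with h | h
    · refine Or.inr ⟨hmono, ?_⟩
      have := card_updateRep_drop hu (hμu hf) hf
      rw [← h] at this
      omega
    · exact Or.inl ⟨hquad (hinterior h), (h3.trans (card_updateRep_le_of_not_isForward γ hf)).trans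
        (Nat.le_succ _)⟩

end Problem

/-! ### Concentration of the sample frequencies. -/

open MeasureTheory ProbabilityTheory

/-- Total deviation of the empirical frequencies of a sample from the uniform distribution. -/
def sampleDeviation {n : ℕ} (M : ℕ) (s : ℕ → Fin n) : ℝ :=
  ∑ i, |1 / (M : ℝ) * ∑ j ∈ Finset.range M, (if s j = i then 1 else 0) - 1 / (n : ℝ)|

lemma sampleDeviation_nonneg {n : ℕ} (M : ℕ) (s : ℕ → Fin n) : 0 ≤ sampleDeviation M s :=
  Finset.sum_nonneg fun _ _ => abs_nonneg _

section Probability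

variable {Ω : Type*} [MeasurableSpace Ω] {μ : Measure Ω} [IsProbabilityMeasure μ]

lemma integral_abs_le_sqrt_integral_sq {Y : Ω → ℝ} (hY : MemLp Y 2 μ) :
    ∫ ω, |Y ω| ∂μ ≤ √(∫ ω, Y ω ^ 2 ∂μ) := by
  have h := variance_nonneg (fun ω => |Y ω|) μ
  rw [variance_eq_sub (X := fun ω => |Y ω|) hY.abs] at h
  simp only [Pi.pow_apply, sq_abs, sub_nonneg] at h
  exact Real.le_sqrt_of_sq_le h

/-- The empirical frequency of an event of pairwise independent indicators concentrates. -/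
lemma integral_abs_average_sub_le {X : ℕ → Ω → ℝ} {a : ℝ} (hX : ∀ j, Measurable (X j))
    (hb : ∀ j ω, |X j ω| ≤ 1) (hE : ∀ j, ∫ ω, X j ω ∂μ = a)
    (hind : Pairwise fun i j => IndepFun (X i) (X j) μ) {M : ℕ} (hM : 0 < M) :
    Integrable (fun ω => |1 / (M : ℝ) * ∑ j ∈ Finset.range M, X j ω - a|) μ ∧
      ∫ ω, |1 / (M : ℝ) * ∑ j ∈ Finset.range M, X j ω - a| ∂μ ≤ 1 / √M := by
  have hM' : (0 : ℝ) < M := by exact_mod_cast hM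
  have hLp : ∀ j, MemLp (X j) 2 μ := fun j =>
    MemLp.of_bound (hX j).aestronglyMeasurable 1 (Filter.Eventually.of_forall (hb j))
  have hsum : MemLp (∑ j ∈ Finset.range M, X j) 2 μ := memLp_finsetSum' _ fun j _ => hLp j
  have hZ : MemLp (fun ω => 1 / (M : ℝ) * ∑ j ∈ Finset.range M, X j ω) 2 μ := by
    have := hsum.const_mul (1 / (M : ℝ))
    simpa only [Finset.sum_apply] using this
  have hY := hZ.sub (memLp_const a)
  have hEZ : ∫ ω, 1 / (M : ℝ) * ∑ j ∈ Finset.range M, X j ω ∂μ = a := by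
    rw [integral_const_mul, integral_finsetSum _ fun j _ => (hLp j).integrable (by norm_num)]
    simp only [hE, Finset.sum_const, Finset.card_range, nsmul_eq_mul]
    field_simp
  have hvar : ∫ ω, (1 / (M : ℝ) * ∑ j ∈ Finset.range M, X j ω - a) ^ 2 ∂μ ≤ 1 / (M : ℝ) := by
    have h1 := variance_eq_integral hZ.1.aemeasurable
    rw [hEZ] at h1
    rw [← h1, variance_const_mul]
    have h2 : (fun ω => ∑ j ∈ Finset.range M, X j ω) = ∑ j ∈ Finset.range M, X j := by
      ext ω; simp
    rw [h2, IndepFun.variance_sum (fun j _ => hLp j) fun i _ j _ hij => hind hij]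
    have h3 : ∀ j ∈ Finset.range M, variance (X j) μ ≤ 1 := by
      intro j _
      refine (variance_le_expectation_sq (hX j).aestronglyMeasurable).trans ?_
      have := integral_mono (hLp j).integrable_sq (integrable_const (1 : ℝ)) (μ := μ) fun ω => by
        have := hb j ω
        rw [← sq_abs]
        exact pow_le_one₀ (abs_nonneg _) this
      simpa using this
    have h4 := Finset.sum_le_card_nsmul _ _ _ h3
    rw [Finset.card_range, nsmul_eq_mul, mul_one] at h4
    calc (1 / (M : ℝ)) ^ 2 * ∑ j ∈ Finset.range M, variance (X j) μ
        ≤ (1 / (M : ℝ)) ^ 2 * (M : ℝ) := by gcongr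
      _ = 1 / (M : ℝ) := by field_simp
  refine ⟨(hY.integrable (by norm_num)).abs, ?_⟩
  refine (integral_abs_le_sqrt_integral_sq hY).trans ?_
  rw [← Real.sqrt_one, ← Real.sqrt_div zero_le_one, Real.sqrt_one]
  exact Real.sqrt_le_sqrt hvar

/-- Each index frequency is an average of pairwise independent indicators of mean `1 / n`; the `n`
individual bounds are added. -/
lemma integral_sampleDeviation_le {n : ℕ} {ξ : ℕ → Ω → Fin n} (hmeas : ∀ j, Measurable (ξ j))
    (hind : Pairwise fun i j => IndepFun (ξ i) (ξ j) μ)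
    (hunif : ∀ j i, μ {ω | ξ j ω = i} = 1 / (n : ENNReal)) {M : ℕ} (hM : 0 < M) :
    Integrable (fun ω => sampleDeviation M fun j => ξ j ω) μ ∧
      ∫ ω, sampleDeviation M (fun j => ξ j ω) ∂μ ≤ n * (1 / √M) := by
  have hi : ∀ i : Fin n, _ := fun i => integral_abs_average_sub_le (μ := μ)
    (X := fun j ω => if ξ j ω = i then (1 : ℝ) else 0) (a := 1 / n)
    (fun j => (Measurable.of_discrete (f := fun a : Fin n => if a = i then (1 : ℝ) else 0)).comp
      (hmeas j))
    (fun j ω => by split_ifs <;> simp)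
    (fun j => by
      have hset : MeasurableSet {ω | ξ j ω = i} := hmeas j (measurableSet_singleton i)
      have : (fun ω => if ξ j ω = i then (1 : ℝ) else 0)
          = Set.indicator {ω | ξ j ω = i} fun _ => 1 := by
        ext ω; simp [Set.indicator_apply]
      rw [this, integral_indicator_const _ hset, measureReal_def, hunif]
      simp)
    (fun j k hjk => (hind hjk).comp
      (φ := fun a : Fin n => if a = i then (1 : ℝ) else 0)
      (ψ := fun a : Fin n => if a = i then (1 : ℝ) else 0)
      Measurable.of_discrete Measurable.of_discrete) hM
  unfold sampleDeviation
  refine ⟨integrable_finsetSum _ fun i _ => (hi i).1, ?_⟩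
  rw [integral_finsetSum _ fun i _ => (hi i).1]
  refine (Finset.sum_le_card_nsmul _ _ _ fun i _ => (hi i).2).trans ?_
  simp

end Probability

/-! ### Linear recursion with geometrically decaying errors. -/

/-- The solution of `b (k + 1) = q b k + A e (k + 1)`. -/
def affineRec (q A a : ℝ) (e : ℕ → ℝ) : ℕ → ℝ
  | 0 => a
  | k + 1 => q * affineRec q A a e k + A * e (k + 1)

/-- The shift by one reflects that iterations are numbered from `1` while the recursion starts at
`0`. -/
lemma le_affineRec {q A a : ℝ} {e Ψ : ℕ → ℝ} (hq : 0 ≤ q) (h0 : Ψ 1 ≤ a)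
    (h : ∀ k, 1 ≤ k → Ψ (k + 1) ≤ q * Ψ k + A * e k) (k : ℕ) :
    Ψ (k + 1) ≤ affineRec q A a e k := by
  induction k with
  | zero => exact h0
  | succ k ih =>
    exact (h (k + 1) (Nat.succ_pos k)).trans
      (add_le_add_left (mul_le_mul_of_nonneg_left ih hq) _)

/-- The added multiple of `r ^ (k + 1)` absorbs the error: its coefficient `c` solves `q c = A B r +
r c`, so the corrected expectation contracts by exactly the factor `q`. -/
lemma integral_affineRec_le {Ω : Type*} [MeasurableSpace Ω] {μ : Measure Ω}
    [IsProbabilityMeasure μ] {q A a r B : ℝ} {e : ℕ → Ω → ℝ} (hA : 0 ≤ A) (hrq : r < q)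
    (hq : 0 < q) (he : ∀ k, 1 ≤ k → Integrable (e k) μ)
    (he' : ∀ k, 1 ≤ k → ∫ ω, e k ω ∂μ ≤ B * r ^ (k + 1)) (k : ℕ) :
    Integrable (fun ω => affineRec q A a (fun k => e k ω) k) μ ∧
      ∫ ω, affineRec q A a (fun k => e k ω) k ∂μ + A * B * r / (q - r) * r ^ (k + 1)
        ≤ q ^ k * (a + A * B * r / (q - r) * r) := by
  induction k with
  | zero => simp [affineRec]
  | succ k ih =>
    have h1 := ih.1.const_mul q
    have h2 := (he (k + 1) (Nat.succ_pos k)).const_mul A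
    refine ⟨h1.add h2, ?_⟩
    simp only [affineRec]
    rw [integral_add h1 h2, integral_const_mul, integral_const_mul]
    have h3 := mul_le_mul_of_nonneg_left (he' (k + 1) (Nat.succ_pos k)) hA
    have h4 := mul_le_mul_of_nonneg_left ih.2 hq.le
    have h5 : A * B * r ^ (k + 1 + 1) + A * B * r / (q - r) * r ^ (k + 1 + 1)
        = q * (A * B * r / (q - r) * r ^ (k + 1)) := by
      have : q - r ≠ 0 := by linarith
      field_simp
      ring
    rw [pow_succ q k]
    linarith

/-! ### From the sampled objective to the expected gap. -/

namespace Problem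

variable {p m n : ℕ} {Q : Problem p m n}

/-- Grouping the sample by index separates the randomness of the sample from the point `x`. The
error bound is thus uniform in `x`, even when `x` depends on the sample. -/
lemma sampleObjective_sub_objective (M : ℕ) (s : ℕ → Fin n) (x : Vec p) :
    Q.sampleObjective M s x - Q.objective x =
      ∑ i, (1 / (M : ℝ) * ∑ j ∈ Finset.range M, (if s j = i then 1 else 0) - 1 / (n : ℝ))
        * Q.f i x := by
  simp only [sub_mul]
  rw [Finset.sum_sub_distrib, objective, sampleObjective, ← Finset.mul_sum]
  congr 1
  simp only [mul_assoc]
  rw [← Finset.mul_sum]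
  congr 1
  simp only [Finset.sum_mul]
  rw [Finset.sum_comm]
  refine Finset.sum_congr rfl fun j _ => ?_
  simp

lemma abs_sampleObjective_sub_objective_le (M : ℕ) (s : ℕ → Fin n) {x : Vec p} {B : ℝ}
    (hB : ∀ i, |Q.f i x| ≤ B) :
    |Q.sampleObjective M s x - Q.objective x| ≤ B * sampleDeviation M s := by
  rw [sampleObjective_sub_objective, sampleDeviation, Finset.mul_sum]
  refine (Finset.abs_sum_le_sum_abs _ _).trans (Finset.sum_le_sum fun i _ => ?_)
  rw [abs_mul, mul_comm]
  exact mul_le_mul_of_nonneg_right (hB i) (abs_nonneg _)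

namespace Regular

variable (hQ : Q.Regular)
include hQ

lemma continuous_objective : Continuous Q.objective := by
  unfold objective
  exact continuous_const.mul (continuous_finsetSum _ fun i _ => (hQ.diff i).continuous)

lemma exists_bound : ∃ B, 0 ≤ B ∧ ∀ x ∈ Q.feasible, ∀ i, |Q.f i x| ≤ B := by
  have h : ∀ i, ∃ B, ∀ x ∈ Q.feasible, |Q.f i x| ≤ B := fun i =>
    hQ.compact.exists_bound_of_continuousOn (hQ.diff i).continuous.continuousOn
  choose B hB using h
  refine ⟨∑ i, |B i|, Finset.sum_nonneg fun _ _ => abs_nonneg _, fun x hx i => ?_⟩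
  exact ((hB i x hx).trans (le_abs_self _)).trans
    (Finset.single_le_sum (f := fun i => |B i|) (fun _ _ => abs_nonneg _) (Finset.mem_univ i))

lemma abs_objective_le {B : ℝ} {x : Vec p} (hB : ∀ i, |Q.f i x| ≤ B) : |Q.objective x| ≤ B := by
  have hn : (0 : ℝ) < n := by exact_mod_cast hQ.pos
  unfold objective
  rw [abs_mul, abs_of_pos (one_div_pos.2 hn), one_div, inv_mul_le_iff₀ hn]
  refine (Finset.abs_sum_le_sum_abs _ _).trans
    ((Finset.sum_le_card_nsmul _ _ _ fun i _ => hB i).trans ?_)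
  simp

lemma exists_minimizer : ∃ y ∈ Q.feasible, Q.objective y = Q.optValue ∧
    ∀ x ∈ Q.feasible, Q.optValue ≤ Q.objective x := by
  obtain ⟨y, hy, hmin⟩ := hQ.compact.exists_isMinOn hQ.nontrivial.nonempty
    hQ.continuous_objective.continuousOn
  have : IsLeast (Q.objective '' Q.feasible) (Q.objective y) :=
    ⟨⟨y, hy, rfl⟩, by rintro _ ⟨x, hx, rfl⟩; exact hmin hx⟩
  refine ⟨y, hy, this.csInf_eq.symm, fun x hx => ?_⟩
  rw [optValue, this.csInf_eq]
  exact hmin hx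

lemma repSize_pos (c : Mode) : 0 < Q.repSize c := by
  cases c with
  | plain =>
    exact (Set.ncard_pos Q.finite_vertices).2
      (nontrivial_vertices hQ.compact hQ.nontrivial).nonempty
  | caratheodory => exact Nat.succ_pos p

lemma rho_denominator_pos (c : Mode) :
    0 < 16 * (Q.repSize c : ℝ) ^ 2 * Q.LF * Metric.diam Q.feasible ^ 2 := by
  have h1 := hQ.LF_pos
  have h2 := diam_pos hQ.compact hQ.nontrivial
  have h3 : (0 : ℝ) < Q.repSize c := by exact_mod_cast hQ.repSize_pos c
  positivity

lemma rho_pos (c : Mode) : 0 < Q.rho c := by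
  have h1 := hQ.σF_pos
  have h2 := facetConst_pos hQ.compact hQ.nontrivial
  exact lt_min (by norm_num) (div_pos (by positivity) (hQ.rho_denominator_pos c))

/-- Follows from `Ω ≤ D`, `σ_F ≤ L_F` and `N ≥ 1`; the cap `1 / 2` in `rho` is therefore never
active. -/
lemma rho_le (c : Mode) : Q.rho c ≤ 1 / 16 := by
  refine (min_le_right _ _).trans ?_
  rw [div_le_iff₀ (hQ.rho_denominator_pos c)]
  have h1 := hQ.σF_pos
  have h2 := facetConst_pos hQ.compact hQ.nontrivial
  have h3 : (1 : ℝ) ≤ Q.repSize c := by exact_mod_cast hQ.repSize_pos c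
  have h4 := hQ.LF_pos
  have h5 := hQ.σF_le_LF
  calc Q.facetConst ^ 2 * Q.σF ≤ Metric.diam Q.feasible ^ 2 * Q.LF := by
        have := facetConst_le_diam hQ.compact hQ.nontrivial
        gcongr
    _ ≤ (Q.repSize c : ℝ) ^ 2 * (Metric.diam Q.feasible ^ 2 * Q.LF) :=
        le_mul_of_one_le_left (by positivity) (one_le_pow₀ h3)
    _ = _ := by ring

lemma rho_mul_le (c : Mode) :
    Q.rho c * (16 * (Q.repSize c : ℝ) ^ 2 * Q.LF * Metric.diam Q.feasible ^ 2)
      ≤ Q.facetConst ^ 2 * Q.σF :=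
  (le_div_iff₀ (hQ.rho_denominator_pos c)).1 (min_le_right _ _)

lemma batch_pos (c : Mode) (k : ℕ) : 0 < Q.batch c k := by
  have := hQ.rho_le c
  have h : 0 < 1 - Q.rho c := by linarith
  exact Nat.ceil_pos.2 (by positivity)

lemma one_div_sqrt_batch_le (c : Mode) (k : ℕ) :
    1 / √(Q.batch c k) ≤ (1 - Q.rho c) ^ (k + 1) := by
  have := hQ.rho_le c
  have h : 0 < 1 - Q.rho c := by linarith
  have h1 : 1 / (1 - Q.rho c) ^ (2 * k + 2) ≤ Q.batch c k := Nat.le_ceil _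
  have h2 : 1 / (1 - Q.rho c) ^ (k + 1) ≤ √(Q.batch c k) := by
    refine Real.le_sqrt_of_sq_le (le_trans (le_of_eq ?_) h1)
    rw [div_pow, one_pow, ← pow_mul]
    congr 2
    ring
  exact (one_div_le (by positivity) (lt_of_lt_of_le (by positivity) h2)).1 h2

/-- A geometric sum with ratio `R = (1 - ρ)⁻² ≥ 1`. The factor `2` pays for the ceiling, because
every rounded quantity is at least `1`. -/
lemma gradEvals_le (c : Mode) (k : ℕ) :
    (Q.gradEvals c k : ℝ) * ((1 / (1 - Q.rho c) ^ 2) - 1)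
      ≤ 2 * (1 / (1 - Q.rho c) ^ 2) ^ (k + 2) := by
  have h1 := hQ.rho_pos c
  have h2 := hQ.rho_le c
  have h : 0 < 1 - Q.rho c := by linarith
  set R := 1 / (1 - Q.rho c) ^ 2 with hR
  have hR1 : 1 ≤ R := by
    rw [hR, le_div_iff₀ (by positivity), one_mul]
    exact pow_le_one₀ h.le (by linarith)
  have hb : ∀ i, (Q.batch c i : ℝ) ≤ 2 * R ^ (i + 1) := by
    intro i
    have h3 : 1 / (1 - Q.rho c) ^ (2 * i + 2) = R ^ (i + 1) := by
      rw [hR, div_pow, one_pow, ← pow_mul]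
      congr 2
    have h4 := Nat.ceil_lt_add_one (a := 1 / (1 - Q.rho c) ^ (2 * i + 2)) (by positivity)
    rw [h3] at h4
    have h5 : 1 ≤ R ^ (i + 1) := one_le_pow₀ hR1
    unfold batch
    rw [h3]
    linarith
  unfold gradEvals
  induction k with
  | zero => simp; positivity
  | succ k ih =>
    rw [Finset.sum_Icc_succ_top (by omega), Nat.cast_add, add_mul]
    have h3 := mul_le_mul_of_nonneg_right (hb (k + 1)) (sub_nonneg.2 hR1)
    have h4 : 2 * R ^ (k + 1 + 1) * (R - 1) = 2 * R ^ (k + 1 + 2) - 2 * R ^ (k + 2) := by ring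
    linarith

/-- The optimality gap, weighted by the size of the active set, contracts in every iteration up to
the sampling deviation. -/
lemma potential_step {c : Mode} {M : ℕ} (hM : 0 < M) {s : ℕ → Fin n}
    {S S' : State p} (hR : Q.Represents (S.U, S.μ) S.x) (hcard : S.U.card ≤ Q.repSize c)
    (hstep : Step Q c M s S S') {b : ℝ} (hb0 : 0 ≤ b) (hb2 : b ≤ 1 / 2)
    (hb : b * (4 * (Q.repSize c : ℝ) ^ 2 * Q.LF * Metric.diam Q.feasible ^ 2) ≤
      Q.facetConst ^ 2 * Q.σF) {B : ℝ} (hB0 : 0 ≤ B)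
    (hB : ∀ x ∈ Q.feasible, ∀ i, |Q.f i x| ≤ B) :
    Q.Represents (S'.U, S'.μ) S'.x ∧ S'.U.card ≤ Q.repSize c ∧
      (1 / √(1 - b)) ^ S'.U.card * (Q.objective S'.x - Q.optValue) ≤
        √(1 - b) * ((1 / √(1 - b)) ^ S.U.card * (Q.objective S.x - Q.optValue)) +
          (1 / √(1 - b)) ^ Q.repSize c * (4 * B) * sampleDeviation M s := by
  obtain ⟨hR', hcard', hor⟩ := hQ.step_spec hM hR hcard hstep hb0 hb2 hb
  refine ⟨hR', hcard', ?_⟩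
  obtain ⟨y, hy, hyopt, hmin⟩ := hQ.exists_minimizer
  have hdev : ∀ z ∈ Q.feasible, _ := fun z hz =>
    abs_le.1 (abs_sampleObjective_sub_objective_le (Q := Q) M s (hB z hz))
  have hx := hdev _ hR.mem_feasible
  have hx' := hdev _ hR'.mem_feasible
  have hy' := hdev _ hy
  have hBe : 0 ≤ B * sampleDeviation M s := mul_nonneg hB0 (sampleDeviation_nonneg M s)
  have hh := sub_nonneg.2 (hmin _ hR.mem_feasible)
  set h := Q.objective S.x - Q.optValue with hdef
  set h' := Q.objective S'.x - Q.optValue with hdef'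
  set q := √(1 - b) with hq
  have hqpos : 0 < q := Real.sqrt_pos.2 (by linarith)
  have hqsq : q * q = 1 - b := Real.mul_self_sqrt (by linarith)
  have hq1 : q ≤ 1 := Real.sqrt_le_one.2 (by linarith)
  set z := 1 / q with hz
  have hz1 : 1 ≤ z := by rw [hz, le_div_iff₀ hqpos, one_mul]; exact hq1
  have hqz : q * z = 1 := by rw [hz]; field_simp
  have herr : z ^ S'.U.card * (4 * (B * sampleDeviation M s)) ≤
      z ^ Q.repSize c * (4 * (B * sampleDeviation M s)) := by
    have := pow_le_pow_right₀ hz1 hcard'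
    gcongr
  have hzc : 0 ≤ z ^ S'.U.card := by positivity
  -- Both cases yield the factor `q`, from `z ^ (c + 1) * q ^ 2 = q * z ^ c` and from `z ^ (c - 1) =
  -- q * z ^ c`. Replacing the sampled objective by `F` costs at most four deviations.
  rcases hor with ⟨hgood, hc⟩ | ⟨hdrop, hc⟩
  · have h1 := hgood y hy
    have h2 : h' ≤ q * q * h + 4 * (B * sampleDeviation M s) := by
      have h3 : (1 - b) * (Q.sampleObjective M s S.x - Q.sampleObjective M s y)
          ≤ (1 - b) * (h + 2 * (B * sampleDeviation M s)) :=
        mul_le_mul_of_nonneg_left (by linarith [hx.2, hy'.1]) (by linarith)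
      have h4 := mul_nonneg hb0 hBe
      rw [hqsq]
      linarith [hx'.1, hy'.2]
    have h3 := mul_le_mul_of_nonneg_left h2 hzc
    have h4 : z ^ S'.U.card * (q * q * h) ≤ z ^ (S.U.card + 1) * (q * q * h) := by
      have := pow_le_pow_right₀ hz1 hc
      gcongr
    have h5 : z ^ (S.U.card + 1) * (q * q * h) = q * (z ^ S.U.card * h) := by
      rw [pow_succ]
      linear_combination (q * z ^ S.U.card * h) * hqz
    linarith
  · have h2 : h' ≤ h + 4 * (B * sampleDeviation M s) := by linarith [hx'.1, hx.2]
    have h3 := mul_le_mul_of_nonneg_left h2 hzc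
    have h4 : z ^ S'.U.card * h ≤ q * (z ^ S.U.card * h) := by
      have h5 := pow_le_pow_right₀ hz1 hc
      have h6 : q * z ^ (S'.U.card + 1) = z ^ S'.U.card := by
        rw [pow_succ]
        linear_combination z ^ S'.U.card * hqz
      have h7 := mul_le_mul_of_nonneg_right (mul_le_mul_of_nonneg_left h5 hqpos.le) hh
      rw [h6] at h7
      linarith
    linarith

/-- Linear convergence in expectation, with a constant that depends only on the problem. -/
lemma expGap_le (c : Mode) {b : ℝ} (hb0 : 0 ≤ b) (hb2 : b ≤ 1 / 2)
    (hb : b * (4 * (Q.repSize c : ℝ) ^ 2 * Q.LF * Metric.diam Q.feasible ^ 2) ≤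
      Q.facetConst ^ 2 * Q.σF) (hrq : 1 - Q.rho c < √(1 - b)) {B : ℝ} (hB0 : 0 ≤ B)
    (hB : ∀ x ∈ Q.feasible, ∀ i, |Q.f i x| ≤ B)
    {Ω : Type*} [MeasurableSpace Ω] {prob : Measure Ω} [IsProbabilityMeasure prob]
    {ξ : ℕ → ℕ → Ω → Fin n} {S : ℕ → Ω → State p} (hrun : IsRun Q c prob ξ S) :
    (∀ k, 1 ≤ k → Integrable (fun ω => Q.objective (S k ω).x) prob) ∧
    ∀ k, expGap Q prob S (k + 1) ≤ √(1 - b) ^ k * (1 / √(1 - b) * (2 * B) +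
      (1 / √(1 - b)) ^ Q.repSize c * (4 * B) * n * (1 - Q.rho c) / (√(1 - b) - (1 - Q.rho c))
        * (1 - Q.rho c)) := by
  have hρ := hQ.rho_le c
  have hr : 0 < 1 - Q.rho c := by linarith
  have hqpos : 0 < √(1 - b) := hr.trans hrq
  have hq1 : √(1 - b) ≤ 1 := Real.sqrt_le_one.2 (by linarith)
  have hz1 : 1 ≤ 1 / √(1 - b) := by rw [le_div_iff₀ hqpos, one_mul]; exact hq1
  obtain ⟨y, hy, hyopt, hmin⟩ := hQ.exists_minimizer
  obtain ⟨x₁, hx₁, hinit⟩ := hrun.init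
  have hrep : ∀ ω k, 1 ≤ k → Q.Represents ((S k ω).U, (S k ω).μ) (S k ω).x ∧
      (S k ω).U.card ≤ Q.repSize c := by
    intro ω k hk
    induction k, hk using Nat.le_induction with
    | base =>
      rw [hinit ω]
      refine ⟨represents_initState hx₁, ?_⟩
      rw [initState, Finset.card_singleton]
      exact hQ.repSize_pos c
    | succ k hk ih =>
      have := hQ.potential_step (hQ.batch_pos c k) ih.1 ih.2 (hrun.step k hk ω) hb0 hb2 hb hB0 hB
      exact ⟨this.1, this.2.1⟩
  have hint : ∀ k, 1 ≤ k → Integrable (fun ω => Q.objective (S k ω).x) prob := fun k hk =>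
    Integrable.of_bound
      (hQ.continuous_objective.measurable.comp (hrun.iterate_measurable k hk)).aestronglyMeasurable
      B (Filter.Eventually.of_forall fun ω =>
        hQ.abs_objective_le (hB _ (hrep ω k hk).1.mem_feasible))
  refine ⟨hint, fun k => ?_⟩
  -- Only the iterates are assumed measurable, not the active sets, so the potential itself is never
  -- integrated. It is bounded pathwise by a recursion driven by the sample deviations alone.
  have hpath : ∀ ω, Q.objective (S (k + 1) ω).x - Q.optValue ≤
      affineRec √(1 - b) ((1 / √(1 - b)) ^ Q.repSize c * (4 * B)) (1 / √(1 - b) * (2 * B))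
        (fun k => sampleDeviation (Q.batch c k) fun j => ξ k j ω) k := by
    intro ω
    refine le_trans ?_ (le_affineRec
      (Ψ := fun k => (1 / √(1 - b)) ^ (S k ω).U.card * (Q.objective (S k ω).x - Q.optValue))
      hqpos.le ?_ (fun k hk => ?_) k)
    · exact le_mul_of_one_le_left
        (sub_nonneg.2 (hmin _ (hrep ω (k + 1) (Nat.succ_pos k)).1.mem_feasible))
        (one_le_pow₀ hz1)
    · rw [hinit ω]
      have h1 := (abs_le.1 (hQ.abs_objective_le (hB x₁ hx₁.1))).2
      have h2 := (abs_le.1 (hQ.abs_objective_le (hB y hy))).1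
      have h3 : ((initState x₁).U).card = 1 := by simp [initState]
      rw [h3, pow_one]
      exact mul_le_mul_of_nonneg_left (by simp only [initState]; linarith) (by positivity)
    · exact (hQ.potential_step (hQ.batch_pos c k) (hrep ω k hk).1 (hrep ω k hk).2
        (hrun.step k hk ω) hb0 hb2 hb hB0 hB).2.2
  have hdev : ∀ k, _ := fun k => integral_sampleDeviation_le (μ := prob) (ξ := ξ k)
    (hrun.sample_measurable k)
    (fun i j hij => hrun.sample_indep.indepFun (i := (k, i)) (j := (k, j)) (by simpa using hij))
    (hrun.sample_uniform k) (hQ.batch_pos c k)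
  obtain ⟨h1, h2⟩ := integral_affineRec_le (μ := prob) (q := √(1 - b))
    (A := (1 / √(1 - b)) ^ Q.repSize c * (4 * B)) (a := 1 / √(1 - b) * (2 * B))
    (r := 1 - Q.rho c) (B := n)
    (e := fun k ω => sampleDeviation (Q.batch c k) fun j => ξ k j ω) (by positivity) hrq hqpos
    (fun k _ => (hdev k).1)
    (fun k _ => (hdev k).2.trans
      (mul_le_mul_of_nonneg_left (hQ.one_div_sqrt_batch_le c k) (Nat.cast_nonneg n))) k
  have h3 : expGap Q prob S (k + 1) ≤ _ :=
    integral_mono ((hint (k + 1) (Nat.succ_pos k)).sub (integrable_const _)) h1 hpath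
  have h4 : 0 ≤ (1 / √(1 - b)) ^ Q.repSize c * (4 * B) * n * (1 - Q.rho c) /
      (√(1 - b) - (1 - Q.rho c)) * (1 - Q.rho c) ^ (k + 1) :=
    mul_nonneg (div_nonneg (by positivity) (sub_nonneg.2 hrq.le)) (by positivity)
  linarith

end Regular

end Problem

end ASFW

end

theorem corollary3 {p m n : ℕ} (Q : ASFW.Problem p m n) (c : ASFW.Mode)
    (hn : 0 < n)
    (hcompact : IsCompact Q.feasible)
    (hnontrivial : Q.feasible.Nontrivial)
    (hσ : ∀ i, 0 < Q.σ i)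
    (hconvex : ∀ i, StrongConvexOn Set.univ (Q.σ i) (Q.f i))
    (hdiff : ∀ i, Differentiable ℝ (Q.f i))
    (hlip : ∀ i, LipschitzWith (Q.L i) (gradient (Q.f i))) :
    ∃ β η C₂ K : ℝ,
      0 < β ∧ β < 1 ∧
      η = Real.log (1 - Q.rho c) / Real.log (1 - β) ∧ 0 < η ∧ η < 1 ∧
      ∀ (Ω : Type*) [MeasurableSpace Ω] (prob : MeasureTheory.Measure Ω)
        [MeasureTheory.IsProbabilityMeasure prob]
        (ξ : ℕ → ℕ → Ω → Fin n) (S : ℕ → Ω → ASFW.State p),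
        ASFW.IsRun Q c prob ξ S →
          (∀ k, 1 ≤ k →
            MeasureTheory.Integrable (fun ω => Q.objective (S k ω).x) prob) ∧
          (∀ k : ℕ, 1 ≤ k →
            ASFW.expGap Q prob S (k + 1) ≤ C₂ * (1 - β) ^ (((k : ℝ) - 1) / 2)) ∧
          (∀ ε : ℝ, 0 < ε → ε ≤ 1 →
            ∃ k : ℕ, ASFW.expGap Q prob S (k + 1) ≤ ε ∧
              (∀ j < k, ε < ASFW.expGap Q prob S (j + 1)) ∧
              (Q.gradEvals c k : ℝ) ≤ K * (1 / ε) ^ (4 * η)) := by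
  have hQ : Q.Regular := ⟨hn, hcompact, hnontrivial, hσ, hconvex, hdiff, hlip⟩
  obtain ⟨B, hB0, hB⟩ := hQ.exists_bound
  have hρ := hQ.rho_pos c
  have hρ' := hQ.rho_le c
  have hden := hQ.rho_denominator_pos c
  have hρmul := hQ.rho_mul_le c
  set ρ := Q.rho c with hρdef
  -- Any `β` with `ρ < β < 2ρ - ρ²` would give `η < 1` and `1 - ρ < √(1 - β)`. One-step contraction
  -- allows even `4ρ`, since `ρ` has `16` in its denominator where `4` suffices.
  set β : ℝ := 3 / 2 * ρ with hβ
  set q : ℝ := √(1 - β) with hq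
  have hβ1 : 0 < 1 - β := by linarith
  have hqpos : 0 < q := Real.sqrt_pos.2 hβ1
  have hqsq : q ^ 2 = 1 - β := Real.sq_sqrt hβ1.le
  have hrpos : 0 < 1 - ρ := by linarith
  have hrq : 1 - ρ < q := Real.lt_sqrt_of_sq_lt (by nlinarith)
  have hq1 : q < 1 := by
    rw [hq, Real.sqrt_lt' one_pos]; linarith
  have hlogβ : Real.log (1 - β) < 0 := Real.log_neg hβ1 (by linarith)
  have hlogρ : Real.log (1 - ρ) < 0 := Real.log_neg hrpos (by linarith)
  set η := Real.log (1 - ρ) / Real.log (1 - β) with hη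
  have hη0 : 0 < η := div_pos_of_neg_of_neg hlogρ hlogβ
  have hη1 : η < 1 := by
    rw [hη, div_lt_one_of_neg hlogβ]
    exact Real.log_lt_log hβ1 (by linarith)
  set C₀ : ℝ := 1 / q * (2 * B) + (1 / q) ^ Q.repSize c * (4 * B) * n * (1 - ρ) /
    (q - (1 - ρ)) * (1 - ρ) with hC₀
  have hC₀nonneg : 0 ≤ C₀ := add_nonneg (by positivity)
    (mul_nonneg (div_nonneg (by positivity) (sub_nonneg.2 hrq.le)) hrpos.le)
  set R : ℝ := 1 / (1 - ρ) ^ 2 with hR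
  have hR1 : 1 < R := by
    rw [hR, lt_div_iff₀ (by positivity), one_mul]
    exact pow_lt_one₀ hrpos.le (by linarith) two_ne_zero
  -- By the definition of `η`, `1 - ρ = (1 - β) ^ η = q ^ (2η)`.
  have hRq : R = (1 / q) ^ (4 * η) := by
    have h1 : 1 - ρ = (1 - β) ^ η := by
      rw [Real.rpow_def_of_pos hβ1, hη, mul_div_cancel₀ _ hlogβ.ne, Real.exp_log hrpos]
    rw [hR, h1, ← hqsq, ← Real.rpow_natCast q 2, ← Real.rpow_mul hqpos.le, ← Real.rpow_natCast,
      ← Real.rpow_mul hqpos.le, one_div, one_div, Real.inv_rpow hqpos.le]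
    congr 2
    push_cast
    ring
  -- The bound obtained is `C₀ q ^ k`, while the claim has `q ^ (k - 1)`; this explains the factor
  -- `q` in `C₂`.
  refine ⟨β, η, q * C₀, 2 * R ^ 3 / (R - 1) * C₀ ^ (4 * η), by positivity, by linarith, rfl, hη0,
    hη1, ?_⟩
  intro Ω _ prob _ ξ S hrun
  obtain ⟨hint, hgap⟩ := hQ.expGap_le c (b := β) (by positivity) (by linarith)
    (by rw [hβ]; linarith [mul_pos hρ hden]) hrq hB0 hB hrun
  refine ⟨hint, fun k hk => ?_, fun ε hε hε1 => ?_⟩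
  · refine (hgap k).trans (le_of_eq ?_)
    obtain ⟨j, rfl⟩ := Nat.exists_eq_add_of_le' hk
    have : (1 - β) ^ (((j + 1 : ℕ) - 1 : ℝ) / 2) = q ^ j := by
      rw [← hqsq, ← Real.rpow_natCast q 2, ← Real.rpow_mul hqpos.le, ← Real.rpow_natCast]
      congr 1
      push_cast
      ring
    rw [this, pow_succ]
    ring
  · classical
    have hex : ∃ k, ASFW.expGap Q prob S (k + 1) ≤ ε := by
      have ht : Filter.Tendsto (fun k : ℕ => q ^ k * C₀) Filter.atTop (nhds 0) := by
        simpa using (tendsto_pow_atTop_nhds_zero_of_lt_one hqpos.le hq1).mul_const C₀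
      obtain ⟨k, hk⟩ := (ht.eventually (gt_mem_nhds hε)).exists
      exact ⟨k, (hgap k).trans hk.le⟩
    refine ⟨Nat.find hex, Nat.find_spec hex, fun j hj => not_le.1 (Nat.find_min hex hj), ?_⟩
    have hfirst : ∀ j < Nat.find hex, ε < q ^ j * C₀ := fun j hj =>
      (not_le.1 (Nat.find_min hex hj)).trans_le (hgap j)
    generalize Nat.find hex = k at hfirst
    have hR0 : 0 < R := one_pos.trans hR1
    have hRsub : 0 < R - 1 := sub_pos.2 hR1
    -- If the initial vertex is already accurate, no gradient is evaluated. Otherwise iteration `j`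
    -- just before the first accurate one has `ε < q ^ j C₀`, which bounds `R ^ j`; the remaining `R
    -- ^ 3` goes into `K`.
    rcases k with _ | j
    · have : Q.gradEvals c 0 = 0 := by simp [ASFW.Problem.gradEvals]
      rw [this, Nat.cast_zero]
      positivity
    · have h1 := hfirst j (Nat.lt_succ_self j)
      have h2 := hQ.gradEvals_le c (j + 1)
      have h3 : (1 / q) ^ j ≤ C₀ * (1 / ε) := by
        rw [div_pow, one_pow, div_le_iff₀ (by positivity), mul_one_div, div_mul_eq_mul_div,
          le_div_iff₀ hε, one_mul, mul_comm C₀]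
        exact h1.le
      have h4 : R ^ j ≤ C₀ ^ (4 * η) * (1 / ε) ^ (4 * η) := by
        rw [← Real.mul_rpow hC₀nonneg (by positivity), hRq, ← Real.rpow_natCast,
          ← Real.rpow_mul (by positivity), mul_comm (4 * η), Real.rpow_mul (by positivity),
          Real.rpow_natCast]
        exact Real.rpow_le_rpow (by positivity) h3 (by positivity)
      have h5 : (Q.gradEvals c (j + 1) : ℝ) ≤ 2 * R ^ (j + 1 + 2) / (R - 1) :=
        (le_div_iff₀ hRsub).2 h2
      calc (Q.gradEvals c (j + 1) : ℝ) ≤ 2 * R ^ (j + 1 + 2) / (R - 1) := h5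
        _ = 2 * R ^ 3 / (R - 1) * R ^ j := by ring
        _ ≤ 2 * R ^ 3 / (R - 1) * (C₀ ^ (4 * η) * (1 / ε) ^ (4 * η)) := by gcongr
        _ = _ := by ring
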